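/- Let $d\ge 1$ and $\alpha\in(0,1)$. Let $\tilde\mu$ be a finite measure on the unit sphere $\mathbb S^{d-1}$, symmetric under $s\mapsto -s$, and let $\nu_\alpha(dy)=\rho^{-1-\alpha}\,d\rho\,\tilde\mu(ds)$ (polar coordinates $y=\rho s$, $\rho>0$, $s\in\mathbb S^{d-1}$) be the corresponding symmetric stable Lévy measure, with operator $L_\alpha\phi(x)=\int(\phi(x+y)-\phi(x))\,\nu_\alpha(dy)$ and Lévy symbol $$\Psi(\lambda)=\int_{\mathbb R^d}\big(e^{i\langle\lambda,y\rangle}-1\big)\,\nu_\alpha(dy)=-\int_{\mathbb S^{d-1}}|\langle\lambda,s\rangle|^\alpha\,\mu(ds),$$ where $\mu=\big(\int_0^\infty(1-\cos r)\,r^{-1-\alpha}\,dr\big)\,\tilde\mu$ is the spectral measure. Assume that $\mu$ is non-degenerate, i.e. for some $\eta\ge1$, $$\eta^{-1}|\lambda|^\alpha\le\int_{\mathbb S^{d-1}}|\langle\lambda,s\rangle|^\alpha\,\mu(ds)\le\eta|\lambda|^\alpha\quad\text{for all }\lambda\in\mathbb R^d,$$ and that $\mu$ has a $C^\infty$ density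 with respect to the Lebesgue (surface) measure on $\mathbb S^{d-1}$ and is equivalent to it (same null sets). For $t>0$ and $y\in\mathbb R^d$ put $$p_\alpha(t,y)=\frac1{(2\pi)^d}\int_{\mathbb R^d}e^{-i\langle y,\lambda\rangle}\exp\Big(-t\int_{\mathbb S^{d-1}}|\langle\lambda,s\rangle|^\alpha\,\mu(ds)\Big)\,d\lambda .$$ Then $p_\alpha(t,\cdot)$ is $C^\infty$ and is the density of the law at time $t$ of the convolution semigroup generated by $L_\alpha$ (the probability measure with characteristic function $e^{t\Psi}$). Moreover, for every $\gamma\in[0,1]$ there is a constant $C>0$, depending only on $d,\alpha,\eta,\gamma$ and $\mu$, such that for all $\ell\in\{1,2\}$ and all $t>0$ the following integral is finite and $$\int_{\mathbb R^d}|y|^\gamma\,|D^\ell_y p_\alpha(t,y)|\,dy\le\frac{C}{t^{(\ell-\gamma)/\alpha}} .$$ The fractional Laplacian $\Delta^{\alpha/2}$ is covered: there is $c>0$ such that, if $\tilde\mu$ is $c$ times the surface measure, then all the above assumptions hold (with $\eta=1$), $\nu_\alpha(dy)=c\,|y|^{-d-\alpha}\,dy$, and $\Psi(\lambda)=-|\lambda|^\alpha$.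 -/

import Mathlib

open MeasureTheory
open scoped Manifold ContDiff

noncomputable section

/-- The Euclidean space `ℝ^d` of dimension `d = n + 1 ≥ 1`. -/
abbrev Eucl (n : ℕ) : Type := EuclideanSpace ℝ (Fin (n + 1))

/-- The unit sphere `S^{d-1}` of `ℝ^d`, where `d = n + 1`; it is a smooth manifold of
dimension `n`. -/
abbrev USphere (n : ℕ) : Type := Metric.sphere (0 : Eucl n) 1

/-- The Lebesgue (surface) measure on the unit sphere. -/
def surfaceMeasure (n : ℕ) : Measure (USphere n) := (volume : Measure (Eucl n)).toSphere

/-- The stable Lévy measure with spherical part `μt`, given in polar coordinates `y = ρ s` by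
`ν(dy) = ρ^{-1-α} dρ μt(ds)`, where `ρ > 0` and `s` is on the unit sphere. -/
def stableLevyMeasure {n : ℕ} (α : ℝ) (μt : Measure (USphere n)) : Measure (Eucl n) :=
  ((((volume : Measure ℝ).restrict (Set.Ioi 0)).withDensity
      (fun ρ => ENNReal.ofReal (ρ ^ (-1 - α)))).prod μt).map (fun q => q.1 • (q.2 : Eucl n))

/-- The Lévy symbol `Ψ(ξ) = ∫ (e^{i⟨ξ,y⟩} - 1) ν(dy)` of the operator
`Lφ(x) = ∫ (φ(x+y) - φ(x)) ν(dy)`. -/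
def levySymbol {n : ℕ} (ν : Measure (Eucl n)) (ξ : Eucl n) : ℂ :=
  ∫ y, (Complex.exp (Complex.I * (inner ℝ ξ y : ℝ)) - 1) ∂ν

/-- `P` is the law at time `t` of the convolution semigroup (of the Lévy process) generated by
`Lφ(x) = ∫ (φ(x+y) - φ(x)) ν(dy)`: the probability measure whose characteristic function is
`exp (t Ψ)`. -/
def IsSemigroupLaw {n : ℕ} (ν : Measure (Eucl n)) (t : ℝ) (P : Measure (Eucl n)) : Prop :=
  IsProbabilityMeasure P ∧ ∀ ξ, charFun P ξ = Complex.exp (t * levySymbol ν ξ)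

/-- The constant `∫_0^∞ (1 - cos r) r^{-1-α} dr` relating the spherical part of a symmetric
stable Lévy measure to its spectral measure. -/
def spectralConst (α : ℝ) : ℝ := ∫ r in Set.Ioi (0 : ℝ), (1 - Real.cos r) * r ^ (-1 - α)

/-- The spectral measure of the symmetric stable Lévy measure with spherical part `μt`; it is
the multiple `μ` of `μt` for which the Lévy symbol is `Ψ(ξ) = -∫ |⟨ξ,s⟩|^α μ(ds)`. -/
def spectralMeasure {n : ℕ} (α : ℝ) (μt : Measure (USphere n)) : Measure (USphere n) :=
  ENNReal.ofReal (spectralConst α) • μt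

/-- `∫ |⟨ξ,s⟩|^α μ(ds)`. -/
def spectralIntegral {n : ℕ} (α : ℝ) (μ : Measure (USphere n)) (ξ : Eucl n) : ℝ :=
  ∫ s, |(inner ℝ ξ (s : Eucl n) : ℝ)| ^ α ∂μ

/-- A measure on the sphere is symmetric if it is invariant under `s ↦ -s`. -/
def IsSymmetricMeasure {n : ℕ} (μ : Measure (USphere n)) : Prop :=
  μ.map (fun s => -s) = μ

/-- Non-degeneracy of the spectral measure `μ`, with constant `η`. -/
def IsNondegenerate {n : ℕ} (α η : ℝ) (μ : Measure (USphere n)) : Prop :=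
  1 ≤ η ∧ ∀ ξ : Eucl n,
    η⁻¹ * ‖ξ‖ ^ α ≤ spectralIntegral α μ ξ ∧ spectralIntegral α μ ξ ≤ η * ‖ξ‖ ^ α

/-- `μ` has a smooth density with respect to the Lebesgue measure of the sphere, and is
equivalent to it (that is, they have the same null sets). -/
def HasSmoothEquivalentDensity {n : ℕ} (μ : Measure (USphere n)) : Prop :=
  (∃ f : USphere n → ℝ, ContMDiff (𝓡 n) 𝓘(ℝ, ℝ) ∞ f ∧ (∀ s, 0 ≤ f s) ∧
    μ = (surfaceMeasure n).withDensity (fun s => ENNReal.ofReal (f s))) ∧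
  μ ≪ surfaceMeasure n ∧ surfaceMeasure n ≪ μ

/-- The heat kernel `p_α(t,y)` of the symmetric stable operator with spectral measure `μ`:
`(2π)^{-d} ∫ e^{-i⟨y,ξ⟩} exp (-t ∫ |⟨ξ,s⟩|^α μ(ds)) dξ`. -/
def stableHeatKernel {n : ℕ} (α : ℝ) (μ : Measure (USphere n)) (t : ℝ) (y : Eucl n) : ℝ :=
  (((2 * Real.pi) ^ (n + 1))⁻¹ : ℝ) *
    (∫ ξ : Eucl n, Complex.exp (-(Complex.I * (inner ℝ y ξ : ℝ))) *
      (Real.exp (-t * spectralIntegral α μ ξ) : ℂ)).re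

end

/-!
Write `ψ(ξ) = ∫ |⟨ξ,s⟩|^α μ(ds)`. By homogeneity of `ψ` the heat kernel at time `t` is
`b^d G(b y)`, where `b = t^{-1/α}` and `G` is the Fourier transform of `exp (-ψ)`, suitably
normalised. The change of variables `z = b y` turns the integral in question into
`t^{-(ℓ-γ)/α} ∫ |z|^γ |D^ℓ G(z)| dz`, so all that is needed is that `(1 + |z|) |D^ℓ G(z)|` is
integrable for `ℓ ≥ 1` (`IsStableDensity.fourier_exp_neg_cosSymbol`). This is delicate only
because `α < 1`: the law with density `G` has no first moment, and the gain of a factor `|z|`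
has to come from the derivative.

The Lévy measure has a density `m`, homogeneous of degree `-d - α` and continuously
differentiable away from the origin (`exists_density_stableLevyMeasure`). A smooth cutoff splits
it into small and large jumps, `ψ = ψ₁ + ψ₂`. The symbol `ψ₁` of the small jumps is smooth with
bounded derivatives, and it differs from `ψ` by a bounded function; together with the lower
bound on `ψ` this makes `exp (-ψ₁)` a Schwartz function
(`IsStableDensity.exists_schwartzMap_mul_exp`), with Fourier transform `Q`, say. The factor
`exp (-ψ₂)` is the characteristic function of a compound Poisson law `Π`, so that `G = Q ∗ Π`
and `D^ℓ G = D^ℓ Q ∗ Π`. For the weighted bound, `Π` is approximated by the laws of random walks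
`S = X₁ + ⋯ + X_N` whose steps have a compactly supported jump density `g / N`. With the weight
split as `L y = L (y - S) + L S`, the first part is harmless, because `Q` is a Schwartz function.
In the second, exchangeability of the steps gives
`E[L S · DQ(y - S)] = N E[L X₁ · DQ(y - S)]`, and an integration by parts in the variable `X₁`
moves the derivative from `Q` to `L · g`
(`integral_smul_convPower_succ`, `lintegral_weight_fderiv_walk_le`). The gradient of `L · m` is of
the order `|w|^{-d-α}`, which is integrable at infinity, although `L · m` itself is not; so the
bound is uniform in the truncation of `g` and in the number of steps
(`IsStableDensity.exists_lintegral_fderiv_mul_middleJumps_le`), and it passes to the limit by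
Fatou's lemma. Since the random walks are all that is used of `Π`, the compound Poisson law
itself never appears.

Smoothness of `G` is immediate from the decay of `exp (-ψ)`. Fourier inversion shows that the heat
kernel has the characteristic function `exp (-tψ)`, and uniqueness of characteristic functions
identifies it with the density of the law (`eq_withDensity_stableHeatKernel`). For the fractional
Laplacian, rotation invariance and homogeneity show that the symbol is a multiple of `|ξ|^α`
(`exists_isotropic_stable`).
-/

noncomputable section

/-! ### Random walks and convolution with their laws -/

section RandomWalk

variable {E : Type*} [NormedAddCommGroup E] [InnerProductSpace ℝ E] [FiniteDimensional ℝ E]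
  [MeasurableSpace E] [BorelSpace E]
variable {V : Type*} [NormedAddCommGroup V] [NormedSpace ℝ V]

/-- The `k`-fold convolution power of a measure: the law after `k` steps of the random walk
started at `0` whose steps have law `π`. -/
def convPower (π : Measure E) : ℕ → Measure E
  | 0 => Measure.dirac 0
  | k + 1 => π.conv (convPower π k)

instance convPower.isProbabilityMeasure (π : Measure E) [IsProbabilityMeasure π] (k : ℕ) :
    IsProbabilityMeasure (convPower π k) := by
  induction k with
  | zero => exact inferInstanceAs (IsProbabilityMeasure (Measure.dirac 0))
  | succ k ih => exact inferInstanceAs (IsProbabilityMeasure (π.conv (convPower π k)))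

instance convPower.sFinite (π : Measure E) [SFinite π] (k : ℕ) : SFinite (convPower π k) := by
  induction k with
  | zero => exact inferInstanceAs (SFinite (Measure.dirac 0))
  | succ k ih => exact inferInstanceAs (SFinite (π.conv (convPower π k)))

lemma charFun_convPower (π : Measure E) [IsProbabilityMeasure π] (k : ℕ) (ξ : E) :
    charFun (convPower π k) ξ = charFun π ξ ^ k := by
  induction k with
  | zero => simp [convPower, charFun_dirac]
  | succ k ih => rw [convPower, charFun_conv, ih, pow_succ']

lemma integrable_norm_convPower {π : Measure E} [IsProbabilityMeasure π]
    (hπ : Integrable (fun w : E => ‖w‖) π) (k : ℕ) :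
    Integrable (fun z : E => ‖z‖) (convPower π k) := by
  induction k with
  | zero => exact integrable_dirac (by simp)
  | succ k ih =>
    have hm : AEStronglyMeasurable (fun z : E => ‖z‖) (π.conv (convPower π k)) := by fun_prop
    have hprod : Integrable (fun p : E × E => ‖p.1‖ + ‖p.2‖) (π.prod (convPower π k)) :=
      (hπ.comp_fst _).add (ih.comp_snd _)
    rw [convPower, Measure.conv, integrable_map_measure (by fun_prop) (by fun_prop)]
    refine hprod.mono' (by fun_prop) (.of_forall fun p => ?_)
    simpa using norm_add_le p.1 p.2

lemma integrable_smul_of_bounded {ρ : Measure E} (hρ : Integrable (fun z : E => ‖z‖) ρ)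
    (L : E →L[ℝ] ℝ) {h : E → V} (hc : Continuous h) {C : ℝ} (hC : ∀ x, ‖h x‖ ≤ C) :
    Integrable (fun z => L z • h z) ρ := by
  refine (hρ.const_mul (‖L‖ * C)).mono' (by fun_prop) (.of_forall fun z => ?_)
  rw [norm_smul]
  calc ‖L z‖ * ‖h z‖ ≤ (‖L‖ * ‖z‖) * C := by
        gcongr
        · exact L.le_opNorm z
        · exact hC z
    _ = _ := by ring

/-- Exchangeability of the steps of a random walk: in the mean of `L S • h S`, where `S` is the
position after `k + 1` steps, each step contributes the same amount. -/
lemma integral_smul_convPower_succ [CompleteSpace V] {π : Measure E} [IsProbabilityMeasure π]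
    (hπ : Integrable (fun w : E => ‖w‖) π) (L : E →L[ℝ] ℝ) (k : ℕ) {h : E → V}
    (hc : Continuous h) {C : ℝ} (hC : ∀ x, ‖h x‖ ≤ C) :
    ∫ z, L z • h z ∂(convPower π (k + 1)) =
      ((k : ℝ) + 1) • ∫ z, ∫ w, L w • h (w + z) ∂π ∂(convPower π k) := by
  induction k generalizing h with
  | zero =>
    have hJ : ∫ z, ∫ w, L w • h (w + z) ∂π ∂(convPower π 0) = ∫ w, L w • h (w + 0) ∂π := by
      rw [convPower, integral_dirac]
    rw [hJ]
    simp [convPower]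
  | succ k ih =>
    have hint2 : Integrable (fun z => L z • h z) (π.conv (convPower π (k + 1))) :=
      integrable_smul_of_bounded (integrable_norm_convPower hπ (k + 2)) L hc hC
    rw [convPower, integral_conv hint2]
    have hn := integrable_norm_convPower hπ (k + 1)
    have hA : ∀ x, Integrable (fun z => L x • h (x + z)) (convPower π (k + 1)) := fun x =>
      ((Integrable.of_bound (C := C) (by fun_prop) (.of_forall fun z => hC _))).smul (L x)
    have hB : ∀ x, Integrable (fun z => L z • h (x + z)) (convPower π (k + 1)) := fun x =>
      integrable_smul_of_bounded hn L (by fun_prop) (fun z => hC _)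
    have hA' : Integrable (fun p : E × E => L p.1 • h (p.1 + p.2))
        (π.prod (convPower π (k + 1))) := by
      refine ((hπ.comp_fst _).const_mul (‖L‖ * C)).mono' (by fun_prop) (.of_forall fun z => ?_)
      rw [norm_smul]
      calc ‖L z.1‖ * ‖h (z.1 + z.2)‖ ≤ (‖L‖ * ‖z.1‖) * C := by
            gcongr
            · exact L.le_opNorm _
            · exact hC _
        _ = _ := by ring
    have hB' : Integrable (fun p : E × E => L p.2 • h (p.1 + p.2))
        (π.prod (convPower π (k + 1))) := by
      refine ((hn.comp_snd _).const_mul (‖L‖ * C)).mono' (by fun_prop) (.of_forall fun z => ?_)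
      rw [norm_smul]
      calc ‖L z.2‖ * ‖h (z.1 + z.2)‖ ≤ (‖L‖ * ‖z.2‖) * C := by
            gcongr
            · exact L.le_opNorm _
            · exact hC _
        _ = _ := by ring
    have hsplit : ∀ x, ∫ z, L (x + z) • h (x + z) ∂(convPower π (k + 1)) =
        ∫ z, L x • h (x + z) ∂(convPower π (k + 1)) +
          ∫ z, L z • h (x + z) ∂(convPower π (k + 1)) := by
      intro x
      rw [← integral_add (hA x) (hB x)]
      simp only [map_add, add_smul]
    simp_rw [hsplit]
    rw [integral_add hA'.integral_prod_left hB'.integral_prod_left]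
    have hfirst : ∫ x, ∫ z, L x • h (x + z) ∂(convPower π (k + 1)) ∂π =
        ∫ z, ∫ w, L w • h (w + z) ∂π ∂(convPower π (k + 1)) :=
      integral_integral_swap hA'
    have hIH : ∀ x, ∫ z, L z • h (x + z) ∂(convPower π (k + 1)) =
        ((k : ℝ) + 1) • ∫ z, ∫ w, L w • h (x + (w + z)) ∂π ∂(convPower π k) := fun x =>
      ih (h := fun z => h (x + z)) (by fun_prop) (fun z => hC _)
    have hG : Integrable (fun u => ∫ w, L w • h (w + u) ∂π) (π.conv (convPower π k)) :=
      hA'.integral_prod_right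
    have hsecond : ∫ u, ∫ w, L w • h (w + u) ∂π ∂(convPower π (k + 1)) =
        ∫ x, ∫ z, ∫ w, L w • h (x + (w + z)) ∂π ∂(convPower π k) ∂π := by
      rw [convPower, integral_conv hG]
      refine integral_congr_ae (.of_forall fun x => integral_congr_ae (.of_forall fun z => ?_))
      refine integral_congr_ae (.of_forall fun w => ?_)
      simp only
      congr 2
      abel
    simp_rw [hIH]
    rw [hfirst, integral_smul, ← hsecond]
    push_cast
    rw [add_smul ((k : ℝ) + 1) 1, one_smul, add_comm]

/-- Convolution with a probability measure does not increase the `L¹` norm. -/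
lemma lintegral_enorm_integral_sub_le (K : Measure E) [IsProbabilityMeasure K] {F : E → V}
    (hF : Continuous F) :
    ∫⁻ y, ‖∫ z, F (y - z) ∂K‖ₑ ≤ ∫⁻ y, ‖F y‖ₑ := by
  calc ∫⁻ y, ‖∫ z, F (y - z) ∂K‖ₑ ≤ ∫⁻ y, ∫⁻ z, ‖F (y - z)‖ₑ ∂K :=
        lintegral_mono fun y => enorm_integral_le_lintegral_enorm _
    _ = ∫⁻ z, ∫⁻ y, ‖F (y - z)‖ₑ ∂volume ∂K := by
        rw [lintegral_lintegral_swap]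
        exact Continuous.aemeasurable (by fun_prop)
    _ = ∫⁻ _, ∫⁻ y, ‖F y‖ₑ ∂volume ∂K := by
        refine lintegral_congr fun z => ?_
        exact lintegral_sub_right_eq_self (fun y => ‖F y‖ₑ) z
    _ = _ := by simp

/-- The law of one step of the walk which, with probability `(∫ g) / N`, makes a jump with law
proportional to `g`, and stays put otherwise. After `N` steps its law approximates the compound
Poisson law with jump density `g`. -/
def walkStep (g : E → ℝ) (N : ℝ) : Measure E :=
  ENNReal.ofReal (1 - (∫ w, g w) / N) • Measure.dirac 0 +
    volume.withDensity (fun w => ENNReal.ofReal (g w / N))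

instance (g : E → ℝ) (N : ℝ) : SFinite (walkStep g N) := by
  unfold walkStep
  infer_instance

variable {g : E → ℝ} {N : ℝ}

lemma walkStep_isProbabilityMeasure (hg : Integrable g) (hg0 : ∀ w, 0 ≤ g w)
    (hN : 0 < N) (hgN : ∫ w, g w ≤ N) : IsProbabilityMeasure (walkStep g N) := by
  constructor
  have h0 : 0 ≤ (∫ w, g w) / N := div_nonneg (integral_nonneg hg0) hN.le
  have h1 : (∫ w, g w) / N ≤ 1 := (div_le_one hN).2 hgN
  rw [walkStep, Measure.add_apply, Measure.smul_apply, measure_univ, withDensity_apply _ .univ,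
    Measure.restrict_univ, ← ofReal_integral_eq_lintegral_ofReal (hg.div_const N)
      (.of_forall fun w => div_nonneg (hg0 w) hN.le), integral_div, smul_eq_mul, mul_one,
    ← ENNReal.ofReal_add (by linarith) h0]
  simp

lemma integrable_withDensity_walk (hg : Continuous g) (hg0 : ∀ w, 0 ≤ g w)
    (hN : 0 < N) {F : E → V} :
    Integrable F (volume.withDensity (fun w => ENNReal.ofReal (g w / N))) ↔
      Integrable (fun w => (g w / N) • F w) := by
  rw [integrable_withDensity_iff_integrable_smul' (by fun_prop) (by simp)]
  simp_rw [ENNReal.toReal_ofReal (div_nonneg (hg0 _) hN.le)]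

lemma integral_walkStep [CompleteSpace V] (hg : Continuous g) (hg0 : ∀ w, 0 ≤ g w) (hN : 0 < N)
    (hgN : ∫ w, g w ≤ N) {F : E → V}
    (hint : Integrable (fun w => g w • F w)) :
    ∫ w, F w ∂(walkStep g N) = (1 - (∫ w, g w) / N) • F 0 + N⁻¹ • ∫ w, g w • F w := by
  have h1 : (∫ w, g w) / N ≤ 1 := (div_le_one hN).2 hgN
  have hint' : Integrable (fun w => (g w / N) • F w) := by
    refine (hint.smul N⁻¹).congr (.of_forall fun w => ?_)
    simp [smul_smul, div_eq_inv_mul]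
  rw [walkStep, integral_add_measure]
  · congr 1
    · rw [integral_smul_measure, integral_dirac,
        ENNReal.toReal_ofReal (by linarith)]
    · rw [integral_withDensity_eq_integral_toReal_smul (by fun_prop) (by simp), ← integral_smul]
      refine integral_congr_ae (.of_forall fun w => ?_)
      simp only
      rw [ENNReal.toReal_ofReal (div_nonneg (hg0 _) hN.le), smul_smul, div_eq_inv_mul]
  · refine Integrable.smul_measure ?_ (by simp)
    exact integrable_dirac (by simp)
  · exact (integrable_withDensity_walk hg hg0 hN).2 hint'

lemma integrable_norm_walkStep (hg : Continuous g) (hgs : HasCompactSupport g)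
    (hg0 : ∀ w, 0 ≤ g w) (hN : 0 < N) :
    Integrable (fun w : E => ‖w‖) (walkStep g N) := by
  refine Integrable.add_measure ?_ ?_
  · refine Integrable.smul_measure ?_ (by simp)
    exact integrable_dirac (by simp)
  · rw [integrable_withDensity_walk hg hg0 hN]
    refine Continuous.integrable_of_hasCompactSupport (by fun_prop) ?_
    refine hgs.mono fun w hw => ?_
    contrapose! hw
    simp [Function.notMem_support.1 hw]

/-- The first-order weighted estimate for the walk. The weight `L` is distributed over the steps
of the walk and over `Q`; for the steps, an integration by parts moves the derivative from `Q` to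
the jump density, so that only the `L¹` norm of the derivative of `L * g` enters. -/
theorem lintegral_weight_fderiv_walk_le [CompleteSpace V] (hg : ContDiff ℝ 1 g)
    (hgs : HasCompactSupport g) (hg0 : ∀ w, 0 ≤ g w) (k : ℕ) (hgN : ∫ w, g w ≤ (k : ℝ) + 1)
    {Q : E → V}
    (hQ : ContDiff ℝ 1 Q) {C : ℝ} (hQ1 : ∀ x, ‖fderiv ℝ Q x‖ ≤ C)
    (L : E →L[ℝ] ℝ) (v : E) :
    (∫⁻ y, ‖L y‖ₑ *
      ‖∫ z, fderiv ℝ Q (y - z) v ∂(convPower (walkStep g ((k : ℝ) + 1)) (k + 1))‖ₑ) ≤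
      (∫⁻ y, ‖L y‖ₑ * ‖fderiv ℝ Q y v‖ₑ) +
        (∫⁻ w, ‖fderiv ℝ (fun w => L w * g w) w v‖ₑ) * ∫⁻ y, ‖Q y‖ₑ := by
  have hN : (0 : ℝ) < (k : ℝ) + 1 := by positivity
  have hgi : Integrable g := hg.continuous.integrable_of_hasCompactSupport hgs
  set π := walkStep g ((k : ℝ) + 1) with hπdef
  have : IsProbabilityMeasure π := walkStep_isProbabilityMeasure hgi hg0 hN hgN
  have hπ1 : Integrable (fun w : E => ‖w‖) π :=
    integrable_norm_walkStep hg.continuous hgs hg0 hN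
  set D : E → V := fun x => fderiv ℝ Q x v with hD
  have hDc : Continuous D := (hQ.continuous_fderiv (by simp)).clm_apply continuous_const
  have hDb : ∀ x, ‖D x‖ ≤ C * ‖v‖ := fun x =>
    ((fderiv ℝ Q x).le_opNorm v).trans (by gcongr; exact hQ1 x)
  set Lg : E → ℝ := fun w => L w * g w with hLg
  have hLgd : ContDiff ℝ 1 Lg := L.contDiff.mul hg
  have hLgs : HasCompactSupport Lg := by
    refine hgs.mono fun w hw => ?_
    contrapose! hw
    simp [hLg, Function.notMem_support.1 hw]
  set φ : E → ℝ := fun w => fderiv ℝ Lg w v with hφ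
  have hφc : Continuous φ := (hLgd.continuous_fderiv (by simp)).clm_apply continuous_const
  have hφs : HasCompactSupport φ := hLgs.fderiv_apply ℝ v
  -- integration by parts against the jump density
  have hparts : ∀ x, ∫ w, Lg w • D (x - w) = ∫ w, φ w • Q (x - w) := by
    intro x
    have hder : ∀ w, fderiv ℝ (fun w => Q (x - w)) w v = - D (x - w) := by
      intro w
      have h1 : HasFDerivAt (fun w => x - w) (-(ContinuousLinearMap.id ℝ E)) w := by
        simpa using (hasFDerivAt_id w).const_sub x
      have h2 := (hQ.differentiable (by simp) (x - w)).hasFDerivAt.comp w h1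
      have h3 : fderiv ℝ (fun w => Q (x - w)) w = _ := h2.fderiv
      rw [h3]
      simp [hD]
    have hQx : ContDiff ℝ 1 (fun w => Q (x - w)) := hQ.comp (contDiff_const.sub contDiff_id)
    have hQc : Continuous Q := hQ.continuous
    have key := integral_smul_fderiv_eq_neg_fderiv_smul_of_integrable (μ := (volume : Measure E))
      (𝕜 := ℝ) (f := Lg) (g := fun w => Q (x - w)) (v := v)
      (Continuous.integrable_of_hasCompactSupport (hφc.smul (by fun_prop)) hφs.smul_right)
      (Continuous.integrable_of_hasCompactSupport
        (by simp_rw [hder]; have := hLgd.continuous; fun_prop) hLgs.smul_right)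
      (Continuous.integrable_of_hasCompactSupport
        (by have := hLgd.continuous; fun_prop) hLgs.smul_right)
      (fun w _ => hLgd.differentiable (by simp) w)
      (fun w _ => hQx.differentiable (by simp) w)
    simp_rw [hder, smul_neg, integral_neg] at key
    exact neg_injective key
  -- the contribution of the steps of the walk
  have hstep : ∀ y, ∫ z, L z • D (y - z) ∂(convPower π (k + 1)) =
      ∫ z, ∫ w, φ w • Q (y - z - w) ∂volume ∂(convPower π k) := by
    intro y
    rw [integral_smul_convPower_succ hπ1 L k (h := fun z => D (y - z)) (by fun_prop)
      (fun x => hDb _), ← integral_smul]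
    refine integral_congr_ae (.of_forall fun z => ?_)
    simp only
    have hI : Integrable (fun w => g w • L w • D (y - (w + z))) := by
      refine Continuous.integrable_of_hasCompactSupport ?_ hgs.smul_right
      have := hg.continuous
      fun_prop
    rw [hπdef, integral_walkStep hg.continuous hg0 hN hgN hI]
    simp only [map_zero, zero_smul, smul_zero, zero_add]
    rw [smul_smul, mul_inv_cancel₀ hN.ne', one_smul, ← hparts]
    refine integral_congr_ae (.of_forall fun w => ?_)
    simp only [hLg]
    rw [smul_smul, mul_comm, sub_sub, add_comm z w]
  have hsplit : ∀ y, L y • ∫ z, D (y - z) ∂(convPower π (k + 1)) =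
      ∫ z, L (y - z) • D (y - z) ∂(convPower π (k + 1)) +
        ∫ z, ∫ w, φ w • Q (y - z - w) ∂volume ∂(convPower π k) := by
    intro y
    have hI0 : Integrable (fun z => D (y - z)) (convPower π (k + 1)) :=
      Integrable.of_bound (C := C * ‖v‖) (by fun_prop) (.of_forall fun z => hDb _)
    have hI1 : Integrable (fun z => L z • D (y - z)) (convPower π (k + 1)) :=
      integrable_smul_of_bounded (integrable_norm_convPower hπ1 _) L (by fun_prop)
        (fun z => hDb _)
    rw [← hstep, ← integral_smul]
    have : ∀ z, L (y - z) • D (y - z) = L y • D (y - z) - L z • D (y - z) := by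
      intro z; rw [map_sub, sub_smul]
    simp_rw [this]
    rw [integral_sub (hI0.fun_smul (L y)) hI1, sub_add_cancel]
  have hQc : Continuous Q := hQ.continuous
  calc ∫⁻ y, ‖L y‖ₑ * ‖∫ z, D (y - z) ∂(convPower π (k + 1))‖ₑ
      = ∫⁻ y, ‖∫ z, L (y - z) • D (y - z) ∂(convPower π (k + 1)) +
        ∫ z, ∫ w, φ w • Q (y - z - w) ∂volume ∂(convPower π k)‖ₑ := by
        refine lintegral_congr fun y => ?_
        rw [← hsplit, enorm_smul]
    _ ≤ ∫⁻ y, (‖∫ z, L (y - z) • D (y - z) ∂(convPower π (k + 1))‖ₑ +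
        ∫⁻ w, ‖φ w‖ₑ * ∫⁻ z, ‖Q (y - z - w)‖ₑ ∂(convPower π k) ∂volume) := by
        refine lintegral_mono fun y => (enorm_add_le _ _).trans ?_
        gcongr
        refine (enorm_integral_le_lintegral_enorm _).trans ?_
        calc ∫⁻ z, ‖∫ w, φ w • Q (y - z - w)‖ₑ ∂(convPower π k)
            ≤ ∫⁻ z, ∫⁻ w, ‖φ w • Q (y - z - w)‖ₑ ∂(volume : Measure E) ∂(convPower π k) :=
              lintegral_mono fun z => enorm_integral_le_lintegral_enorm _
          _ = ∫⁻ w, ∫⁻ z, ‖φ w • Q (y - z - w)‖ₑ ∂(convPower π k) ∂volume := by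
              rw [lintegral_lintegral_swap]
              exact Continuous.aemeasurable (by fun_prop)
          _ = _ := by
              refine lintegral_congr fun w => ?_
              simp_rw [enorm_smul]
              rw [lintegral_const_mul]
              exact Continuous.measurable (by fun_prop)
    _ = (∫⁻ y, ‖∫ z, L (y - z) • D (y - z) ∂(convPower π (k + 1))‖ₑ) +
        ∫⁻ y, ∫⁻ w, ‖φ w‖ₑ * ∫⁻ z, ‖Q (y - z - w)‖ₑ ∂(convPower π k) ∂volume := by
        refine lintegral_add_left ?_ _
        refine StronglyMeasurable.enorm ?_
        exact StronglyMeasurable.integral_prod_right'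
          (f := fun p : E × E => L (p.1 - p.2) • D (p.1 - p.2))
          (Continuous.stronglyMeasurable (by fun_prop))
    _ ≤ _ := by
        refine add_le_add ?_ ?_
        · refine (lintegral_enorm_integral_sub_le _ (F := fun x => L x • D x)
            (by fun_prop)).trans (le_of_eq ?_)
          simp_rw [enorm_smul]; rfl
        · refine le_of_eq ?_
          have hm : Measurable (fun p : E × E => ∫⁻ z, ‖Q (p.1 - z - p.2)‖ₑ ∂(convPower π k)) :=
            Measurable.lintegral_prod_right'
              (f := fun q : (E × E) × E => ‖Q (q.1.1 - q.2 - q.1.2)‖ₑ)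
              (Continuous.measurable (by fun_prop))
          rw [lintegral_lintegral_swap]
          · have hinner : ∀ w, ∫⁻ y, ‖φ w‖ₑ * ∫⁻ z, ‖Q (y - z - w)‖ₑ ∂(convPower π k) =
                ‖φ w‖ₑ * ∫⁻ y, ‖Q y‖ₑ := by
              intro w
              have hmw : Measurable fun y => ∫⁻ z, ‖Q (y - z - w)‖ₑ ∂(convPower π k) :=
                hm.comp (measurable_id.prodMk measurable_const)
              rw [lintegral_const_mul _ hmw,
                lintegral_lintegral_swap]
              · congr 1
                have : ∀ z, ∫⁻ y, ‖Q (y - z - w)‖ₑ = ∫⁻ y, ‖Q y‖ₑ := by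
                  intro z
                  simp_rw [sub_sub]
                  exact lintegral_sub_right_eq_self (fun y => ‖Q y‖ₑ) (z + w)
                simp [this]
              · exact Continuous.aemeasurable (by fun_prop)
            simp_rw [hinner]
            rw [lintegral_mul_const]
            exact hφc.measurable.enorm
          · exact Measurable.aemeasurable
              ((hφc.measurable.enorm.comp measurable_snd).mul hm)

end RandomWalk

/-! ### Symbols of Lévy densities -/

section Symbol

open scoped RealInnerProductSpace FourierTransform

variable {E : Type*} [NormedAddCommGroup E] [InnerProductSpace ℝ E]

lemma one_sub_cos_le_abs (x : ℝ) : 1 - Real.cos x ≤ |x| := by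
  have h := Real.abs_sin_le_one (x / 2)
  have h2 : |Real.sin (x / 2)| ≤ |x / 2| := Real.abs_sin_le_abs
  have h3 : Real.cos x = 1 - 2 * Real.sin (x / 2) ^ 2 := by
    have := Real.cos_two_mul (x / 2)
    rw [show 2 * (x / 2) = x by ring] at this
    rw [this, Real.cos_sq']; ring
  rw [h3]
  have h4 : Real.sin (x / 2) ^ 2 = |Real.sin (x / 2)| * |Real.sin (x / 2)| := by
    rw [← sq, sq_abs]
  have h5 : |x / 2| = |x| / 2 := by rw [abs_div]; simp
  nlinarith [abs_nonneg (Real.sin (x / 2)), abs_nonneg x]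

lemma one_sub_cos_inner_nonneg (w ξ : E) : 0 ≤ 1 - Real.cos (2 * Real.pi * ⟪w, ξ⟫) :=
  sub_nonneg.2 (Real.cos_le_one _)

lemma one_sub_cos_inner_le (w ξ : E) :
    1 - Real.cos (2 * Real.pi * ⟪w, ξ⟫) ≤ 2 * Real.pi * ‖ξ‖ * ‖w‖ := by
  refine (one_sub_cos_le_abs _).trans ?_
  rw [abs_mul, abs_of_pos Real.two_pi_pos]
  have := abs_real_inner_le_norm w ξ
  nlinarith [Real.pi_pos]

lemma one_sub_cos_inner_le_min (w ξ : E) :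
    1 - Real.cos (2 * Real.pi * ⟪w, ξ⟫) ≤ (2 + 2 * Real.pi * ‖ξ‖) * min 1 ‖w‖ := by
  have h1 := one_sub_cos_inner_le w ξ
  have h2 := Real.neg_one_le_cos (2 * Real.pi * ⟪w, ξ⟫)
  have h3 : 0 ≤ 2 * Real.pi * ‖ξ‖ := by positivity
  rcases min_cases 1 ‖w‖ with ⟨h, _⟩ | ⟨h, _⟩ <;> rw [h]
  · linarith
  · nlinarith [norm_nonneg w]

/-- A stretched exponential decays faster than every power. -/
lemma exists_pow_mul_exp_neg_rpow_le {c β : ℝ} (hc : 0 < c) (hβ : 0 < β) (k : ℕ) :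
    ∃ C : ℝ, ∀ x : ℝ, 0 ≤ x → x ^ k * Real.exp (-(c * x ^ β)) ≤ C := by
  obtain ⟨n, hn⟩ := exists_nat_ge ((k : ℝ) / β)
  have hn' : (k : ℝ) ≤ β * n := by rwa [div_le_iff₀ hβ, mul_comm] at hn
  refine ⟨1 + n.factorial / c ^ n, fun x hx => ?_⟩
  have hexp : 0 < Real.exp (-(c * x ^ β)) := Real.exp_pos _
  have hnn : 0 ≤ (n.factorial : ℝ) / c ^ n := by positivity
  have hu : 0 ≤ c * x ^ β := by positivity
  rcases le_total x 1 with h | h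
  · have h1 : x ^ k ≤ 1 := pow_le_one₀ hx h
    have h2 : Real.exp (-(c * x ^ β)) ≤ 1 := Real.exp_le_one_iff.2 (by linarith)
    nlinarith [pow_nonneg hx k]
  · have h1 : x ^ k ≤ (x ^ β) ^ n := by
      rw [← Real.rpow_natCast, ← Real.rpow_natCast, ← Real.rpow_mul hx]
      exact Real.rpow_le_rpow_of_exponent_le h hn'
    have h2 := Real.pow_div_factorial_le_exp _ hu n
    have h3 : (c * x ^ β) ^ n * Real.exp (-(c * x ^ β)) ≤ n.factorial := by
      rw [div_le_iff₀ (by positivity)] at h2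
      calc (c * x ^ β) ^ n * Real.exp (-(c * x ^ β))
          ≤ (Real.exp (c * x ^ β) * n.factorial) * Real.exp (-(c * x ^ β)) := by gcongr
        _ = n.factorial * (Real.exp (c * x ^ β) * Real.exp (-(c * x ^ β))) := by ring
        _ = _ := by rw [← Real.exp_add]; simp
    calc x ^ k * Real.exp (-(c * x ^ β)) ≤ (x ^ β) ^ n * Real.exp (-(c * x ^ β)) := by gcongr
      _ ≤ n.factorial / c ^ n := by
          rw [le_div_iff₀ (by positivity)]
          calc _ = (c * x ^ β) ^ n * Real.exp (-(c * x ^ β)) := by rw [mul_pow]; ring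
            _ ≤ _ := h3
      _ ≤ _ := by linarith

/-- If `φ` is smooth with bounded derivatives of positive order and grows like a power, then
`exp (-φ)` is a Schwartz function: by the Faà di Bruno formula its derivatives are bounded by
multiples of `exp (-φ)` itself. -/
theorem exists_schwartzMap_exp_neg {φ : E → ℝ} (hφ : ContDiff ℝ ∞ φ)
    (hb : ∀ i : ℕ, 1 ≤ i → ∃ C : ℝ, ∀ ξ, ‖iteratedFDeriv ℝ i φ ξ‖ ≤ C)
    {c β A : ℝ} (hc : 0 < c) (hβ : 0 < β) (hlow : ∀ ξ, c * ‖ξ‖ ^ β - A ≤ φ ξ) :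
    ∃ s : SchwartzMap E ℂ, ∀ ξ, s ξ = (Real.exp (-φ ξ) : ℂ) := by
  set e : ℝ → ℝ := fun x => Real.exp (-x) with he
  have hecd : ContDiff ℝ ∞ e := Real.contDiff_exp.comp contDiff_neg
  have hed : ∀ (i : ℕ) (x : ℝ), ‖iteratedFDeriv ℝ i e x‖ = Real.exp (-x) := by
    intro i x
    rw [norm_iteratedFDeriv_eq_norm_iteratedDeriv, he, iteratedDeriv_comp_neg,
      iteratedDeriv_eq_iterate, Real.iter_deriv_exp, norm_smul]
    simp
  have hcd : ContDiff ℝ ∞ (fun ξ => Real.exp (-φ ξ)) := Real.contDiff_exp.comp hφ.neg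
  have hcd' : ContDiff ℝ ∞ (fun ξ => (Real.exp (-φ ξ) : ℂ)) :=
    Complex.ofRealCLM.contDiff.comp hcd
  refine ⟨⟨fun ξ => (Real.exp (-φ ξ) : ℂ), hcd', fun k n => ?_⟩, fun ξ => rfl⟩
  choose! B hB using hb
  set D : ℝ := 1 + ∑ i ∈ Finset.range (n + 1), |B i| with hD
  have hD1 : 1 ≤ D := by
    have : 0 ≤ ∑ i ∈ Finset.range (n + 1), |B i| := Finset.sum_nonneg fun i _ => abs_nonneg _
    linarith
  have hBD : ∀ i ≤ n, B i ≤ D := by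
    intro i hi
    have : |B i| ≤ ∑ i ∈ Finset.range (n + 1), |B i| :=
      Finset.single_le_sum (f := fun i => |B i|) (fun i _ => abs_nonneg _)
        (Finset.mem_range.2 (by omega))
    linarith [le_abs_self (B i)]
  obtain ⟨M, hM⟩ := exists_pow_mul_exp_neg_rpow_le hc hβ k
  refine ⟨n.factorial * D ^ n * (Real.exp A * M), fun ξ => ?_⟩
  have h1 : ‖iteratedFDeriv ℝ n (fun ξ => (Real.exp (-φ ξ) : ℂ)) ξ‖ =
      ‖iteratedFDeriv ℝ n (fun ξ => Real.exp (-φ ξ)) ξ‖ :=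
    Complex.ofRealLI.norm_iteratedFDeriv_comp_left hcd.contDiffAt (by exact_mod_cast le_top)
  have h2 : ‖iteratedFDeriv ℝ n (fun ξ => Real.exp (-φ ξ)) ξ‖ ≤
      n.factorial * Real.exp (-φ ξ) * D ^ n := by
    refine norm_iteratedFDeriv_comp_le hecd hφ (by exact_mod_cast le_top) ξ
      (fun i _ => (hed i _).le) (fun i hi hin => ?_)
    calc ‖iteratedFDeriv ℝ i φ ξ‖ ≤ B i := hB i hi ξ
      _ ≤ D := hBD i hin
      _ ≤ D ^ i := le_self_pow₀ hD1 (by omega)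
  have h3 : Real.exp (-φ ξ) ≤ Real.exp A * Real.exp (-(c * ‖ξ‖ ^ β)) := by
    rw [← Real.exp_add]
    exact Real.exp_le_exp.2 (by linarith [hlow ξ])
  have h4 := hM ‖ξ‖ (norm_nonneg _)
  change ‖ξ‖ ^ k * ‖iteratedFDeriv ℝ n (fun ξ => (Real.exp (-φ ξ) : ℂ)) ξ‖ ≤ _
  rw [h1]
  calc ‖ξ‖ ^ k * ‖iteratedFDeriv ℝ n (fun ξ => Real.exp (-φ ξ)) ξ‖
      ≤ ‖ξ‖ ^ k * (n.factorial * (Real.exp A * Real.exp (-(c * ‖ξ‖ ^ β))) * D ^ n) := by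
        gcongr
        exact h2.trans (by gcongr)
    _ = n.factorial * D ^ n * (Real.exp A * (‖ξ‖ ^ k * Real.exp (-(c * ‖ξ‖ ^ β)))) := by ring
    _ ≤ _ := by gcongr

variable [FiniteDimensional ℝ E] [MeasurableSpace E] [BorelSpace E]

/-- The symbol `∫ (1 - cos (2π⟪w, ξ⟫)) g(w) dw` of an even jump density `g`. The factor `2π`
matches the normalisation of the Fourier transform. -/
def cosSymbol (g : E → ℝ) (ξ : E) : ℝ :=
  ∫ w, (1 - Real.cos (2 * Real.pi * ⟪w, ξ⟫)) * g w

lemma cosSymbol_nonneg {g : E → ℝ} (hg : ∀ w, 0 ≤ g w) (ξ : E) : 0 ≤ cosSymbol g ξ :=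
  integral_nonneg fun w => mul_nonneg (one_sub_cos_inner_nonneg w ξ) (hg w)

lemma integrable_cosSymbol {g : E → ℝ} (hm : AEStronglyMeasurable g)
    (hg : Integrable (fun w => min 1 ‖w‖ * g w)) (ξ : E) :
    Integrable (fun w => (1 - Real.cos (2 * Real.pi * ⟪w, ξ⟫)) * g w) := by
  refine (hg.norm.const_mul (2 + 2 * Real.pi * ‖ξ‖)).mono' ?_ (.of_forall fun w => ?_)
  · exact AEStronglyMeasurable.mul (Continuous.aestronglyMeasurable (by fun_prop)) hm
  · rw [norm_mul, norm_mul, Real.norm_of_nonneg (one_sub_cos_inner_nonneg w ξ),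
      Real.norm_of_nonneg (show 0 ≤ min 1 ‖w‖ by positivity), ← mul_assoc]
    gcongr
    exact one_sub_cos_inner_le_min w ξ

open Real in
/-- The symbol of a jump density with finite moments of all positive orders is smooth, and its
derivatives of positive order are bounded. -/
theorem contDiff_cosSymbol_and_bounded {k : E → ℝ} (hm : AEStronglyMeasurable k)
    (hk : ∀ i : ℕ, 1 ≤ i → Integrable (fun w => ‖w‖ ^ i * k w)) :
    ContDiff ℝ ∞ (cosSymbol k) ∧
      ∀ i : ℕ, 1 ≤ i → ∃ C : ℝ, ∀ ξ, ‖iteratedFDeriv ℝ i (cosSymbol k) ξ‖ ≤ C := by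
  have hk1 : Integrable (fun w => ‖w‖ * k w) := by simpa using hk 1 le_rfl
  set kc : E → ℂ := fun w => (k w : ℂ) with hkc
  have hkcm : AEStronglyMeasurable kc := Complex.continuous_ofReal.comp_aestronglyMeasurable hm
  set F : E → (E →L[ℝ] ℂ) := VectorFourier.fourierSMulRight (innerSL ℝ) kc with hF
  have hFm : AEStronglyMeasurable F := hkcm.fourierSMulRight
  have hFn : ∀ w, ‖F w‖ ≤ 2 * π * (‖w‖ * |k w|) := fun w => by
    rw [hF, VectorFourier.norm_fourierSMulRight]
    rw [innerSL_apply_norm, mul_assoc]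
    simp [hkc]
  have hFi : ∀ i : ℕ, Integrable (fun w => ‖w‖ ^ i * ‖F w‖) := by
    intro i
    refine ((hk (i + 1) (by omega)).norm.const_mul (2 * π)).mono'
      (AEStronglyMeasurable.mul (Continuous.aestronglyMeasurable (by fun_prop)) hFm.norm)
      (.of_forall fun w => ?_)
    rw [norm_mul, norm_norm, norm_pow, norm_norm, norm_mul, norm_pow, norm_norm, Real.norm_eq_abs]
    calc ‖w‖ ^ i * ‖F w‖ ≤ ‖w‖ ^ i * (2 * π * (‖w‖ * |k w|)) := by gcongr; exact hFn w
      _ = _ := by ring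
  -- the complex symbol; only its gradient is a Fourier transform of an integrable function
  set Z : E → ℂ := fun ξ => ∫ w, ((1 : ℂ) - (𝐞 (-⟪w, ξ⟫) : ℂ)) * kc w with hZ
  have hchar : ∀ w ξ : E, (𝐞 (-⟪w, ξ⟫) : ℂ) =
      (Real.cos (2 * π * ⟪w, ξ⟫) : ℂ) - (Real.sin (2 * π * ⟪w, ξ⟫) : ℂ) * Complex.I := by
    intro w ξ
    rw [Real.fourierChar_apply, Complex.exp_mul_I, ← Complex.ofReal_cos, ← Complex.ofReal_sin,
      show 2 * π * -⟪w, ξ⟫ = -(2 * π * ⟪w, ξ⟫) by ring, Real.cos_neg, Real.sin_neg]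
    push_cast; ring
  have hbound : ∀ w ξ : E, ‖(1 : ℂ) - (𝐞 (-⟪w, ξ⟫) : ℂ)‖ ≤ 2 * π * ‖ξ‖ * ‖w‖ := by
    intro w ξ
    rw [norm_sub_rev, Real.fourierChar_apply, mul_comm _ Complex.I]
    refine (Real.norm_exp_I_mul_ofReal_sub_one_le).trans ?_
    rw [Real.norm_eq_abs, abs_mul, abs_neg, abs_of_pos Real.two_pi_pos]
    have := abs_real_inner_le_norm w ξ
    nlinarith [Real.pi_pos]
  have hZmeas : ∀ ξ, AEStronglyMeasurable (fun w => ((1 : ℂ) - (𝐞 (-⟪w, ξ⟫) : ℂ)) * kc w) := by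
    intro ξ
    refine AEStronglyMeasurable.mul (Continuous.aestronglyMeasurable ?_) hkcm
    simp_rw [hchar]
    fun_prop
  have hZint : ∀ ξ, Integrable (fun w => ((1 : ℂ) - (𝐞 (-⟪w, ξ⟫) : ℂ)) * kc w) := by
    intro ξ
    refine (hk1.norm.const_mul (2 * π * ‖ξ‖)).mono' (hZmeas ξ) (.of_forall fun w => ?_)
    rw [norm_mul, norm_mul, norm_norm, ← mul_assoc]
    refine mul_le_mul (hbound w ξ) (by simp [hkc]) (norm_nonneg _) (by positivity)
  have hFint0 : Integrable F := (integrable_norm_iff hFm).1 (by simpa using hFi 0)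
  have hderiv : ∀ ξ, HasFDerivAt Z (-(𝓕 F ξ)) ξ := by
    intro ξ
    have hFξ : -(𝓕 F ξ) = ∫ w, -(𝐞 (-⟪w, ξ⟫) • F w) := by
      rw [Real.fourier_eq, integral_neg]
    have hFint : Integrable (fun w => 𝐞 (-⟪w, ξ⟫) • F w) :=
      (Real.fourierIntegral_convergent_iff ξ).2 hFint0
    rw [hFξ]
    refine hasFDerivAt_integral_of_dominated_of_fderiv_le (s := Set.univ)
      (F := fun ξ w => ((1 : ℂ) - (𝐞 (-⟪w, ξ⟫) : ℂ)) * kc w)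
      (F' := fun ξ w => -(𝐞 (-⟪w, ξ⟫) • F w)) (bound := fun w => ‖F w‖) Filter.univ_mem
      (.of_forall fun ξ => hZmeas ξ) (hZint ξ) hFint.1.neg ?_ hFint0.norm ?_
    · refine .of_forall fun w x _ => ?_
      rw [norm_neg]
      exact (Circle.norm_smul (𝐞 (-⟪w, x⟫)) (F w)).le
    · refine .of_forall fun w x _ => ?_
      have h1 := VectorFourier.hasFDerivAt_fourierChar_smul (innerSL ℝ) kc w x
      have h2 := (hasFDerivAt_const (kc w) x).sub h1
      rw [zero_sub] at h2
      refine h2.congr_of_eventuallyEq (.of_forall fun y => ?_)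
      simp only [Pi.sub_apply]
      rw [sub_mul, one_mul]
      rfl
  have hfd : fderiv ℝ Z = fun ξ => -(𝓕 F ξ) := funext fun ξ => (hderiv ξ).fderiv
  have hFcd : ContDiff ℝ ∞ (𝓕 F) := Real.contDiff_fourier (N := ⊤) fun n _ => hFi n
  have hZcd : ContDiff ℝ ∞ Z := by
    rw [contDiff_infty_iff_fderiv]
    refine ⟨fun ξ => (hderiv ξ).differentiableAt, ?_⟩
    rw [hfd]
    exact hFcd.neg
  have hre : cosSymbol k = fun ξ => Complex.reCLM (Z ξ) := by
    funext ξ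
    rw [hZ, ← Complex.reCLM.integral_comp_comm (hZint ξ), cosSymbol]
    refine integral_congr_ae (.of_forall fun w => ?_)
    simp only [hkc]
    rw [hchar]
    simp [-Complex.ofReal_cos, -Complex.ofReal_sin]
  refine ⟨?_, fun i hi => ?_⟩
  · rw [hre]
    exact Complex.reCLM.contDiff.comp hZcd
  · obtain ⟨j, rfl⟩ : ∃ j, i = j + 1 := ⟨i - 1, by omega⟩
    refine ⟨∫ w, ‖VectorFourier.fourierPowSMulRight (innerSL ℝ) F w j‖, fun ξ => ?_⟩
    have h1 : ‖iteratedFDeriv ℝ (j + 1) (cosSymbol k) ξ‖ ≤ ‖iteratedFDeriv ℝ (j + 1) Z ξ‖ := by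
      rw [hre]
      refine (Complex.reCLM.norm_iteratedFDeriv_comp_left (hZcd.contDiffAt)
        (n := j + 1) (by exact_mod_cast le_top)).trans ?_
      rw [Complex.reCLM_norm, one_mul]
    refine h1.trans ?_
    rw [← norm_iteratedFDeriv_fderiv, hfd]
    have h2 : iteratedFDeriv ℝ j (fun ξ => -(𝓕 F ξ)) ξ = -(iteratedFDeriv ℝ j (𝓕 F) ξ) :=
      iteratedFDeriv_neg_apply
    rw [h2, norm_neg, Real.iteratedFDeriv_fourier (N := ⊤) (fun n _ => hFi n) hFm le_top,
      Real.fourier_eq]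
    refine (norm_integral_le_integral_norm _).trans (le_of_eq ?_)
    simp

end Symbol

/-! ### Stable densities and their truncations -/

section StableDensity

variable {E : Type*} [NormedAddCommGroup E] [InnerProductSpace ℝ E] [FiniteDimensional ℝ E]

/-- The properties of the density `m` of a symmetric `α`-stable Lévy measure that the estimates
depend on: it is even (up to a null set), continuously differentiable away from the origin, and
it and its gradient are bounded as if they were homogeneous of degree `-d - α` and
`-d - α - 1`, where `d` is the dimension. -/
structure IsStableDensity [MeasurableSpace E] [BorelSpace E] (α M : ℝ) (m : E → ℝ) : Prop where
  nonneg : ∀ y, 0 ≤ m y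
  contDiffAt : ∀ y, y ≠ 0 → ContDiffAt ℝ 1 m y
  const_nonneg : 0 ≤ M
  le_rpow : ∀ y, y ≠ 0 → m y ≤ M * ‖y‖ ^ (-(Module.finrank ℝ E : ℝ) - α)
  norm_fderiv_le : ∀ y, y ≠ 0 →
    ‖fderiv ℝ m y‖ ≤ M * ‖y‖ ^ (-(Module.finrank ℝ E : ℝ) - α - 1)
  even : ∀ᵐ y, m (-y) = m y

/-- A smooth even function with values in `[0, 1]`, equal to `1` on the ball of radius `R` and to
`0` outside the ball of radius `2 * R`. -/
def cutoff (R : ℝ) (w : E) : ℝ :=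
  (⟨1, 2, one_pos, one_lt_two⟩ : ContDiffBump (0 : E)) (R⁻¹ • w)

lemma contDiff_cutoff (R : ℝ) : ContDiff ℝ ∞ (cutoff R : E → ℝ) :=
  (ContDiffBump.contDiff _).comp (contDiff_const_smul _)

lemma cutoff_nonneg (R : ℝ) (w : E) : 0 ≤ cutoff R w := ContDiffBump.nonneg _

lemma cutoff_le_one (R : ℝ) (w : E) : cutoff R w ≤ 1 := ContDiffBump.le_one _

lemma cutoff_eq_one {R : ℝ} (hR : 0 < R) {w : E} (hw : ‖w‖ ≤ R) : cutoff R w = 1 := by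
  refine ContDiffBump.one_of_mem_closedBall _ ?_
  rw [mem_closedBall_zero_iff, norm_smul, norm_inv, Real.norm_of_nonneg hR.le]
  exact (inv_mul_le_one₀ hR).2 hw

lemma cutoff_eq_zero {R : ℝ} (hR : 0 < R) {w : E} (hw : 2 * R ≤ ‖w‖) : cutoff R w = 0 := by
  refine ContDiffBump.zero_of_le_dist _ ?_
  rw [dist_zero_right, norm_smul, norm_inv, Real.norm_of_nonneg hR.le]
  change 2 ≤ _
  rw [le_inv_mul_iff₀ hR]
  linarith

lemma cutoff_neg (R : ℝ) (w : E) : cutoff R (-w) = cutoff R w := by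
  rw [cutoff, smul_neg, ContDiffBump.neg, cutoff]

/-- The gradient of the cutoff at scale `R` is bounded by `B / ‖w‖`, uniformly in `R`. -/
lemma exists_norm_mul_norm_fderiv_cutoff_le :
    ∃ B : ℝ, 0 ≤ B ∧ ∀ R : ℝ, 0 < R → ∀ w : E, ‖w‖ * ‖fderiv ℝ (cutoff R) w‖ ≤ B := by
  set b : ContDiffBump (0 : E) := ⟨1, 2, one_pos, one_lt_two⟩ with hb
  have hbd : ContDiff ℝ ∞ (b : E → ℝ) := b.contDiff
  have hc : Continuous (fun w : E => ‖w‖ * ‖fderiv ℝ b w‖) :=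
    continuous_norm.mul (hbd.continuous_fderiv (by simp)).norm
  have hs : HasCompactSupport (fun w : E => ‖w‖ * ‖fderiv ℝ b w‖) :=
    (b.hasCompactSupport.fderiv ℝ).norm.mul_left
  obtain ⟨B, hB⟩ := hc.bounded_above_of_compact_support hs
  refine ⟨B, (norm_nonneg _).trans (hB 0), fun R hR w => ?_⟩
  have h1 : fderiv ℝ (cutoff R) w = R⁻¹ • fderiv ℝ b (R⁻¹ • w) :=
    fderiv_comp_smul (f := (b : E → ℝ)) (x := w) R⁻¹
  have h2 := (le_abs_self _).trans (hB (R⁻¹ • w))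
  rw [norm_smul, norm_inv, Real.norm_of_nonneg hR.le] at h2
  rw [h1, norm_smul, norm_inv, Real.norm_of_nonneg hR.le]
  rwa [mul_left_comm, ← mul_assoc]

/-- The part of the density `m` that belongs to jumps of size between `1` and `2 * R`. It is used
for `2 ≤ R`, where the cutoff at scale `R` dominates the one at scale `1`. -/
def middleJumps (m : E → ℝ) (R : ℝ) (w : E) : ℝ := (cutoff R w - cutoff 1 w) * m w

/-- The part of the density `m` that belongs to jumps of size at least `1`. -/
def largeJumps (m : E → ℝ) (w : E) : ℝ := (1 - cutoff 1 w) * m w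

lemma middleJumps_eq_zero {m : E → ℝ} {R : ℝ} (hR : 2 ≤ R) {w : E} (hw : ‖w‖ ≤ 1) :
    middleJumps m R w = 0 := by
  rw [middleJumps, cutoff_eq_one (by linarith) (by linarith), cutoff_eq_one one_pos hw]
  simp

lemma middleJumps_eventuallyEq_zero {m : E → ℝ} {R : ℝ} (hR : 2 ≤ R) {w : E} (hw : ‖w‖ < 1) :
    middleJumps m R =ᶠ[nhds w] 0 := by
  filter_upwards [(isOpen_lt continuous_norm continuous_const).mem_nhds hw] with x hx
  exact middleJumps_eq_zero hR (le_of_lt hx)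

lemma hasCompactSupport_middleJumps {m : E → ℝ} {R : ℝ} (hR : 2 ≤ R) :
    HasCompactSupport (middleJumps m R) := by
  refine HasCompactSupport.intro (isCompact_closedBall (0 : E) (2 * R)) fun w hw => ?_
  rw [mem_closedBall_zero_iff, not_le] at hw
  rw [middleJumps, cutoff_eq_zero (by linarith) hw.le, cutoff_eq_zero one_pos (by linarith)]
  simp

variable [MeasurableSpace E] [BorelSpace E]

/-- Both the Lévy condition at the origin (for `α < 1` with the first power of the norm) and the
integrability at infinity. -/
lemma integrable_min_mul_rpow [Nontrivial E] {α : ℝ} (hα0 : 0 < α) (hα1 : α < 1) :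
    Integrable (fun y : E => min 1 ‖y‖ * ‖y‖ ^ (-(Module.finrank ℝ E : ℝ) - α)) := by
  rw [integrable_fun_norm_addHaar volume
    (f := fun r : ℝ => min 1 r * r ^ (-(Module.finrank ℝ E : ℝ) - α))]
  have hd : 0 < Module.finrank ℝ E := Module.finrank_pos
  have hpow : ∀ r : ℝ, 0 < r → r ^ (Module.finrank ℝ E - 1) *
      r ^ (-(Module.finrank ℝ E : ℝ) - α) = r ^ (-1 - α) := by
    intro r hr
    rw [← Real.rpow_natCast, ← Real.rpow_add hr, Nat.cast_sub hd]
    congr 1; push_cast; ring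
  rw [← Set.Ioc_union_Ioi_eq_Ioi zero_le_one, integrableOn_union]
  constructor
  · have h : IntegrableOn (fun r : ℝ => r ^ (-α)) (Set.Ioc 0 1) := by
      rw [← intervalIntegrable_iff_integrableOn_Ioc_of_le zero_le_one]
      exact intervalIntegral.intervalIntegrable_rpow' (by linarith)
    refine h.congr_fun (fun r hr => ?_) measurableSet_Ioc
    simp only [smul_eq_mul]
    rw [min_eq_right hr.2, mul_left_comm, hpow r hr.1, ← Real.rpow_one_add' hr.1.le (by linarith)]
    congr 1; ring
  · have h : IntegrableOn (fun r : ℝ => r ^ (-1 - α)) (Set.Ioi 1) :=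
      integrableOn_Ioi_rpow_of_lt (by linarith) one_pos
    refine h.congr_fun (fun r hr => ?_) measurableSet_Ioi
    simp only [smul_eq_mul]
    rw [min_eq_left (Set.mem_Ioi.1 hr).le, one_mul, hpow r (one_pos.trans hr)]

namespace IsStableDensity

variable {α M : ℝ} {m : E → ℝ}

lemma aestronglyMeasurable [Nontrivial E] (h : IsStableDensity α M m) :
    AEStronglyMeasurable m := by
  have h1 : ContinuousOn m {0}ᶜ := fun y hy => (h.contDiffAt y hy).continuousAt.continuousWithinAt
  have h2 := h1.aestronglyMeasurable (μ := volume) (measurableSet_singleton (0 : E)).compl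
  rwa [restrict_compl_singleton] at h2

lemma integrable_min_mul [Nontrivial E] (h : IsStableDensity α M m) (hα0 : 0 < α) (hα1 : α < 1) :
    Integrable (fun y => min 1 ‖y‖ * m y) := by
  refine ((integrable_min_mul_rpow (E := E) hα0 hα1).const_mul M).mono'
    (AEStronglyMeasurable.mul (Continuous.aestronglyMeasurable (by fun_prop))
      h.aestronglyMeasurable) (.of_forall fun y => ?_)
  rw [Real.norm_of_nonneg (mul_nonneg (by positivity) (h.nonneg y))]
  rcases eq_or_ne y 0 with rfl | hy
  · simp
  · calc min 1 ‖y‖ * m y ≤ min 1 ‖y‖ * (M * ‖y‖ ^ (-(Module.finrank ℝ E : ℝ) - α)) := by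
          gcongr; exact h.le_rpow y hy
      _ = _ := by ring

/-- The density of the small jumps, that is, those of size at most `2`, has finite moments of all
positive orders. -/
lemma integrable_pow_mul_small [Nontrivial E] (h : IsStableDensity α M m) (hα0 : 0 < α)
    (hα1 : α < 1) (i : ℕ) (hi : 1 ≤ i) :
    Integrable (fun w => ‖w‖ ^ i * (cutoff 1 w * m w)) := by
  refine ((h.integrable_min_mul hα0 hα1).const_mul (2 ^ i)).mono' ?_ (.of_forall fun y => ?_)
  · refine AEStronglyMeasurable.mul (Continuous.aestronglyMeasurable (by fun_prop))
      (AEStronglyMeasurable.mul ?_ h.aestronglyMeasurable)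
    exact (contDiff_cutoff 1).continuous.aestronglyMeasurable
  · have h0 := h.nonneg y
    have h1 := cutoff_nonneg 1 y
    rw [Real.norm_of_nonneg (by positivity)]
    rcases le_or_gt (2 * 1) ‖y‖ with hy | hy
    · rw [cutoff_eq_zero one_pos hy]
      simp only [zero_mul, mul_zero]
      positivity
    · have h2 : ‖y‖ ^ i ≤ 2 ^ i * min 1 ‖y‖ := by
        obtain ⟨j, rfl⟩ : ∃ j, i = j + 1 := ⟨i - 1, by omega⟩
        have h3 : ‖y‖ ^ j ≤ 2 ^ j := pow_le_pow_left₀ (norm_nonneg _) (by linarith) j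
        have h4 : ‖y‖ ≤ 2 * min 1 ‖y‖ := by
          rcases min_cases 1 ‖y‖ with ⟨h, _⟩ | ⟨h, _⟩ <;> rw [h]
          · linarith
          · linarith [norm_nonneg y]
        rw [pow_succ, pow_succ, mul_assoc]
        gcongr
      calc ‖y‖ ^ i * (cutoff 1 y * m y) ≤ (2 ^ i * min 1 ‖y‖) * (1 * m y) := by
            gcongr
            exact cutoff_le_one 1 y
        _ = _ := by ring

lemma middleJumps_nonneg (h : IsStableDensity α M m) {R : ℝ} (hR : 2 ≤ R) (w : E) :
    0 ≤ middleJumps m R w := by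
  refine mul_nonneg (sub_nonneg.2 ?_) (h.nonneg w)
  rcases le_total ‖w‖ R with hw | hw
  · rw [cutoff_eq_one (by linarith) hw]
    exact cutoff_le_one 1 w
  · rw [cutoff_eq_zero one_pos (w := w) (by linarith)]
    exact cutoff_nonneg R w

lemma largeJumps_nonneg (h : IsStableDensity α M m) (w : E) : 0 ≤ largeJumps m w :=
  mul_nonneg (sub_nonneg.2 (cutoff_le_one 1 w)) (h.nonneg w)

lemma middleJumps_le (h : IsStableDensity α M m) (R : ℝ) (w : E) :
    middleJumps m R w ≤ largeJumps m w := by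
  refine mul_le_mul_of_nonneg_right ?_ (h.nonneg w)
  linarith [cutoff_le_one R w]

lemma largeJumps_le_min (h : IsStableDensity α M m) (w : E) :
    largeJumps m w ≤ min 1 ‖w‖ * m w := by
  refine mul_le_mul_of_nonneg_right ?_ (h.nonneg w)
  rcases le_total ‖w‖ 1 with hw | hw
  · rw [cutoff_eq_one one_pos hw]
    simp
  · rw [min_eq_left hw]
    linarith [cutoff_nonneg 1 w]

lemma integrable_largeJumps [Nontrivial E] (h : IsStableDensity α M m) (hα0 : 0 < α)
    (hα1 : α < 1) : Integrable (largeJumps m) := by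
  refine (h.integrable_min_mul hα0 hα1).mono' ?_ (.of_forall fun w => ?_)
  · refine AEStronglyMeasurable.mul (Continuous.aestronglyMeasurable ?_) h.aestronglyMeasurable
    exact continuous_const.sub (contDiff_cutoff 1).continuous
  · rw [Real.norm_of_nonneg (h.largeJumps_nonneg w)]
    exact h.largeJumps_le_min w

lemma contDiff_middleJumps (h : IsStableDensity α M m) {R : ℝ} (hR : 2 ≤ R) :
    ContDiff ℝ 1 (middleJumps m R) := by
  rw [contDiff_iff_contDiffAt]
  intro w
  rcases lt_or_ge ‖w‖ 1 with hw | hw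
  · exact contDiffAt_const.congr_of_eventuallyEq (middleJumps_eventuallyEq_zero hR hw)
  · have hw0 : w ≠ 0 := by rintro rfl; simp at hw; linarith
    have h1 : ContDiffAt ℝ 1 (fun w : E => cutoff R w - cutoff 1 w) w :=
      (((contDiff_cutoff R).sub (contDiff_cutoff 1)).of_le (by simp)).contDiffAt
    exact h1.mul (h.contDiffAt w hw0)

lemma even_middleJumps (h : IsStableDensity α M m) (R : ℝ) :
    ∀ᵐ w, middleJumps m R (-w) = middleJumps m R w := by
  filter_upwards [h.even] with w hw
  rw [middleJumps, cutoff_neg, cutoff_neg, hw, middleJumps]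

/-- Multiplying the truncated density by a linear form and differentiating costs nothing at
infinity: the `L¹` norm stays bounded as the truncation is removed, although the first moment
of the density is infinite. -/
theorem exists_lintegral_fderiv_mul_middleJumps_le [Nontrivial E] (h : IsStableDensity α M m)
    (hα0 : 0 < α) (hα1 : α < 1) :
    ∃ C : ENNReal, C ≠ ⊤ ∧ ∀ R : ℝ, 2 ≤ R → ∀ (L : E →L[ℝ] ℝ) (v : E), ‖L‖ ≤ 1 → ‖v‖ ≤ 1 →
      ∫⁻ w, ‖fderiv ℝ (fun w => L w * middleJumps m R w) w v‖ₑ ≤ C := by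
  obtain ⟨B, hB0, hB⟩ := exists_norm_mul_norm_fderiv_cutoff_le (E := E)
  have hM := h.const_nonneg
  have hint := (integrable_min_mul_rpow (E := E) hα0 hα1).const_mul ((2 * B + 2) * M)
  refine ⟨∫⁻ w, ‖(2 * B + 2) * M * (min 1 ‖w‖ *
    ‖w‖ ^ (-(Module.finrank ℝ E : ℝ) - α))‖ₑ, hint.2.ne, fun R hR L v hL hv => ?_⟩
  refine lintegral_mono fun w => ?_
  have hnn : 0 ≤ (2 * B + 2) * M *
      (min 1 ‖w‖ * ‖w‖ ^ (-(Module.finrank ℝ E : ℝ) - α)) := by positivity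
  rw [enorm_le_iff_norm_le, Real.norm_of_nonneg hnn]
  rcases lt_or_ge ‖w‖ 1 with hw | hw
  · have h0 : (fun w => L w * middleJumps m R w) =ᶠ[nhds w] fun _ => 0 := by
      filter_upwards [middleJumps_eventuallyEq_zero (m := m) hR hw] with x hx
      rw [hx]; simp
    rw [h0.fderiv_eq]
    simpa using hnn
  · have hw0 : w ≠ 0 := by rintro rfl; simp at hw; linarith
    have hwp : 0 < ‖w‖ := by linarith
    set P := ‖w‖ ^ (-(Module.finrank ℝ E : ℝ) - α) with hP
    have hP0 : 0 ≤ P := by positivity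
    rw [min_eq_left hw, one_mul]
    have hmP := h.le_rpow w hw0
    have hdmP : ‖w‖ * ‖fderiv ℝ m w‖ ≤ M * P := by
      have := h.norm_fderiv_le w hw0
      rw [Real.rpow_sub_one hwp.ne'] at this
      calc ‖w‖ * ‖fderiv ℝ m w‖ ≤ ‖w‖ * (M * (P / ‖w‖)) := by gcongr
        _ = _ := by field_simp
    have hθd : ∀ R : ℝ, DifferentiableAt ℝ (cutoff R : E → ℝ) w := fun R =>
      ((contDiff_cutoff R).differentiable (by simp)) w
    have hd1 := ((hθd R).hasFDerivAt.sub (hθd 1).hasFDerivAt)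
    have hd2 := ((h.contDiffAt w hw0).differentiableAt (by simp)).hasFDerivAt
    have hd3 := L.hasFDerivAt (x := w) |>.mul (hd1.mul hd2)
    have hd4 : fderiv ℝ (fun w => L w * middleJumps m R w) w = _ := hd3.fderiv
    rw [hd4]
    have hm0 := h.nonneg w
    have hLw : |L w| ≤ ‖w‖ := (L.le_opNorm w).trans (by nlinarith [norm_nonneg w])
    have hLv : |L v| ≤ 1 := (L.le_opNorm v).trans (by nlinarith [norm_nonneg v, norm_nonneg L])
    have hop : ∀ T : E →L[ℝ] ℝ, |T v| ≤ ‖T‖ := fun T =>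
      (T.le_opNorm v).trans (mul_le_of_le_one_right (norm_nonneg _) hv)
    have hθ : |cutoff R w - cutoff 1 w| ≤ 1 := by
      rw [abs_le]
      constructor <;> linarith [cutoff_nonneg R w, cutoff_le_one R w, cutoff_nonneg 1 w,
        cutoff_le_one 1 w]
    have e1 : ‖w‖ * |fderiv ℝ (cutoff R) w v| ≤ B :=
      (mul_le_mul_of_nonneg_left (hop _) (norm_nonneg _)).trans (hB R (by linarith) w)
    have e2 : ‖w‖ * |fderiv ℝ (cutoff 1) w v| ≤ B :=
      (mul_le_mul_of_nonneg_left (hop _) (norm_nonneg _)).trans (hB 1 one_pos w)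
    have e3 : ‖w‖ * |fderiv ℝ m w v| ≤ M * P :=
      (mul_le_mul_of_nonneg_left (hop _) (norm_nonneg _)).trans hdmP
    simp only [add_apply, smul_apply, smul_eq_mul,
      sub_apply, Pi.sub_apply, Pi.mul_apply, Real.norm_eq_abs]
    set θ := cutoff R w - cutoff 1 w
    set a := fderiv ℝ (cutoff R) w v
    set b := fderiv ℝ (cutoff 1) w v
    set c := fderiv ℝ m w v
    -- the three terms of the product rule
    have t1 : |L w * (θ * c)| ≤ M * P := by
      rw [abs_mul, abs_mul]
      calc |L w| * (|θ| * |c|) ≤ ‖w‖ * (1 * |c|) := by gcongr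
        _ = ‖w‖ * |c| := by ring
        _ ≤ _ := e3
    have t2 : |L w * (m w * (a - b))| ≤ 2 * B * (M * P) := by
      rw [abs_mul, abs_mul, abs_of_nonneg hm0]
      calc |L w| * (m w * |a - b|) ≤ ‖w‖ * (m w * (|a| + |b|)) := by gcongr; exact abs_sub _ _
        _ = m w * (‖w‖ * |a| + ‖w‖ * |b|) := by ring
        _ ≤ (M * P) * (B + B) := by gcongr
        _ = _ := by ring
    have t3 : |θ * m w * L v| ≤ M * P := by
      rw [abs_mul, abs_mul, abs_of_nonneg hm0]
      calc |θ| * m w * |L v| ≤ 1 * (M * P) * 1 := by gcongr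
        _ = _ := by ring
    calc |L w * (θ * c + m w * (a - b)) + θ * m w * L v|
        = |L w * (θ * c) + L w * (m w * (a - b)) + θ * m w * L v| := by ring_nf
      _ ≤ |L w * (θ * c)| + |L w * (m w * (a - b))| + |θ * m w * L v| := abs_add_three _ _ _
      _ ≤ (2 * B + 2) * M * P := by linarith

end IsStableDensity

end StableDensity

/-! ### Approximation of the large jumps by random walks -/

section Core

open scoped RealInnerProductSpace FourierTransform Topology
open Filter

variable {E : Type*} [NormedAddCommGroup E] [InnerProductSpace ℝ E]

lemma enorm_le_sum_enorm_apply_basis {V : Type*} [NormedAddCommGroup V] [NormedSpace ℝ V]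
    {ι : Type*} [Fintype ι] (e : OrthonormalBasis ι ℝ E) (T : E →L[ℝ] V) :
    ‖T‖ₑ ≤ ∑ i, ‖T (e i)‖ₑ := by
  have h : ‖T‖ ≤ ∑ i, ‖T (e i)‖ := by
    refine T.opNorm_le_bound (Finset.sum_nonneg fun i _ => norm_nonneg _) fun x => ?_
    conv_lhs => rw [← e.sum_repr x, map_sum]
    refine (norm_sum_le _ _).trans ?_
    rw [Finset.sum_mul]
    refine Finset.sum_le_sum fun i _ => ?_
    rw [map_smul, norm_smul, mul_comm]
    gcongr
    rw [e.repr_apply_apply]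
    refine (norm_inner_le_norm _ _).trans ?_
    rw [e.norm_eq_one, one_mul]
  calc ‖T‖ₑ = ENNReal.ofReal ‖T‖ := (ofReal_norm T).symm
    _ ≤ ENNReal.ofReal (∑ i, ‖T (e i)‖) := ENNReal.ofReal_le_ofReal h
    _ = _ := by
      rw [ENNReal.ofReal_sum_of_nonneg fun i _ => norm_nonneg _]
      simp_rw [ofReal_norm]

lemma enorm_le_sum_enorm_inner_basis {ι : Type*} [Fintype ι] (e : OrthonormalBasis ι ℝ E)
    (y : E) : ‖y‖ₑ ≤ ∑ i, ‖innerSL ℝ (e i) y‖ₑ := by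
  calc ‖y‖ₑ = ‖∑ i, ⟪e i, y⟫ • e i‖ₑ := by rw [e.sum_repr' y]
    _ ≤ ∑ i, ‖⟪e i, y⟫ • e i‖ₑ := enorm_sum_le _ _
    _ = _ := by
      refine Finset.sum_congr rfl fun i _ => ?_
      rw [enorm_smul, ← ofReal_norm (e i), e.norm_eq_one]
      simp

variable [FiniteDimensional ℝ E] [MeasurableSpace E] [BorelSpace E]

/-- The Fourier integral of an even integrable density in terms of its symbol. -/
lemma integral_smul_cexp_of_even {g : E → ℝ} (hg : Integrable g)
    (he : ∀ᵐ w, g (-w) = g w) (ξ : E) :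
    ∫ w, g w • Complex.exp (⟪w, (2 * Real.pi) • ξ⟫ * Complex.I) =
      ((∫ w, g w) - cosSymbol g ξ : ℝ) := by
  set J := ∫ w, g w • Complex.exp (⟪w, (2 * Real.pi) • ξ⟫ * Complex.I) with hJ
  have hexp : ∀ w, Complex.exp (⟪w, (2 * Real.pi) • ξ⟫ * Complex.I) =
      (Real.cos (2 * Real.pi * ⟪w, ξ⟫) : ℂ) +
        (Real.sin (2 * Real.pi * ⟪w, ξ⟫) : ℂ) * Complex.I := by
    intro w
    rw [Complex.exp_mul_I, ← Complex.ofReal_cos, ← Complex.ofReal_sin, real_inner_smul_right]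
  have hint : Integrable (fun w => g w • Complex.exp (⟪w, (2 * Real.pi) • ξ⟫ * Complex.I)) := by
    refine hg.norm.mono' (hg.1.smul (Continuous.aestronglyMeasurable (by fun_prop)))
      (.of_forall fun w => ?_)
    rw [norm_smul, Complex.norm_exp_ofReal_mul_I, mul_one]
  have hconj : (starRingEnd ℂ) J = J := by
    rw [hJ, ← integral_conj, ← integral_neg_eq_self]
    refine integral_congr_ae ?_
    filter_upwards [he] with w hw
    rw [hw, inner_neg_left]
    simp [← Complex.exp_conj]
  have hre : J.re = (∫ w, g w) - cosSymbol g ξ := by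
    rw [hJ, ← Complex.reCLM_apply, ← Complex.reCLM.integral_comp_comm hint, cosSymbol]
    have hgc : Integrable (fun w => (1 - Real.cos (2 * Real.pi * ⟪w, ξ⟫)) * g w) := by
      refine (hg.norm.const_mul 2).mono'
        (AEStronglyMeasurable.mul (Continuous.aestronglyMeasurable (by fun_prop)) hg.1)
        (.of_forall fun w => ?_)
      rw [norm_mul, Real.norm_of_nonneg (one_sub_cos_inner_nonneg w ξ)]
      gcongr
      linarith [Real.neg_one_le_cos (2 * Real.pi * ⟪w, ξ⟫)]
    rw [← integral_sub hg hgc]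
    refine integral_congr_ae (.of_forall fun w => ?_)
    simp only [hexp, Complex.reCLM_apply, Complex.smul_re]
    simp [-Complex.ofReal_cos, -Complex.ofReal_sin]
    ring
  rw [← hre]
  exact (Complex.conj_eq_iff_re.1 hconj).symm

/-- The characteristic function of the law of the walk after `N` steps. -/
lemma charFun_walk {g : E → ℝ} (hg : Continuous g) (hgs : HasCompactSupport g)
    (hg0 : ∀ w, 0 ≤ g w) (he : ∀ᵐ w, g (-w) = g w) (k : ℕ) (hgN : ∫ w, g w ≤ (k : ℝ) + 1)
    (ξ : E) :
    charFun (convPower (walkStep g ((k : ℝ) + 1)) (k + 1)) ((2 * Real.pi) • ξ) =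
      ((1 + -(cosSymbol g ξ) / ((k : ℝ) + 1)) ^ (k + 1) : ℝ) := by
  have hN : (0 : ℝ) < (k : ℝ) + 1 := by positivity
  have hgi : Integrable g := hg.integrable_of_hasCompactSupport hgs
  have := walkStep_isProbabilityMeasure hgi hg0 hN hgN
  rw [charFun_convPower, charFun_apply, integral_walkStep hg hg0 hN hgN,
    integral_smul_cexp_of_even hgi he]
  · rw [Complex.ofReal_pow]
    congr 1
    rw [inner_zero_left, Complex.ofReal_zero, zero_mul, Complex.exp_zero, ← Complex.ofReal_one,
      Complex.real_smul, Complex.real_smul, ← Complex.ofReal_mul, ← Complex.ofReal_mul,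
      ← Complex.ofReal_add]
    congr 1
    field_simp
    ring
  · exact Continuous.integrable_of_hasCompactSupport (by fun_prop) hgs.smul_right

/-- Convolving a Fourier transform with a probability measure multiplies the transformed function
by the characteristic function. -/
lemma integral_fourier_sub {V : Type*} [NormedAddCommGroup V] [NormedSpace ℂ V] [CompleteSpace V]
    (K : Measure E) [IsProbabilityMeasure K] {a : E → V} (ha : Integrable a) (y : E) :
    ∫ z, 𝓕 a (y - z) ∂K =
      ∫ v, 𝐞 (-⟪v, y⟫) • charFun K ((2 * Real.pi) • v) • a v := by
  have hsplit : ∀ v z : E, 𝐞 (-⟪v, y - z⟫) • a v =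
      𝐞 (-⟪v, y⟫) • (Complex.exp (⟪z, (2 * Real.pi) • v⟫ * Complex.I)) • a v := by
    intro v z
    rw [Circle.smul_def, Circle.smul_def, smul_smul, inner_sub_right, neg_sub, sub_eq_neg_add,
      AddChar.map_add_eq_mul, Circle.coe_mul, Real.fourierChar_apply (⟪v, z⟫),
      real_inner_smul_right, real_inner_comm v z]
  have hprod : Integrable (fun p : E × E => 𝐞 (-⟪p.2, y - p.1⟫) • a p.2) (K.prod volume) := by
    have h1 : Integrable (fun p : E × E => a p.2) (K.prod volume) := ha.comp_snd K
    refine h1.norm.mono' ?_ (.of_forall fun p => (Circle.norm_smul _ _).le)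
    exact AEStronglyMeasurable.fun_smul (Continuous.aestronglyMeasurable (by fun_prop)) h1.1
  calc ∫ z, 𝓕 a (y - z) ∂K = ∫ z, ∫ v, 𝐞 (-⟪v, y - z⟫) • a v ∂volume ∂K := rfl
    _ = ∫ v, ∫ z, 𝐞 (-⟪v, y - z⟫) • a v ∂K := integral_integral_swap hprod
    _ = _ := by
      refine integral_congr_ae (.of_forall fun v => ?_)
      simp only [hsplit, Circle.smul_def]
      rw [integral_smul, integral_smul_const, charFun_apply]

/-- Fatou's lemma for a pointwise convergent sequence with bounded integrals. -/
lemma lintegral_le_of_tendsto {f : ℕ → E → ENNReal} {F : E → ENNReal} {C : ENNReal}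
    (hf : ∀ k, Measurable (f k)) (hF : ∀ y, Tendsto (fun k => f k y) atTop (𝓝 (F y)))
    (hC : ∀ᶠ k in atTop, ∫⁻ y, f k y ≤ C) : ∫⁻ y, F y ≤ C := by
  calc ∫⁻ y, F y = ∫⁻ y, liminf (fun k => f k y) atTop :=
        lintegral_congr fun y => (hF y).liminf_eq.symm
    _ ≤ liminf (fun k => ∫⁻ y, f k y) atTop := lintegral_liminf_le hf
    _ ≤ C := liminf_le_of_frequently_le' hC.frequently

/-- The law of the walk that approximates the large jumps: its jump density is truncated at a
radius which grows with the number of steps. -/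
def walkLaw (m : E → ℝ) (k : ℕ) : Measure E :=
  convPower (walkStep (middleJumps m ((k : ℝ) + 2)) ((k : ℝ) + 1)) (k + 1)

namespace IsStableDensity

variable {α M : ℝ} {m : E → ℝ}

lemma isProbabilityMeasure_walkLaw (h : IsStableDensity α M m) {k : ℕ}
    (hk : ∫ w, middleJumps m ((k : ℝ) + 2) w ≤ (k : ℝ) + 1) :
    IsProbabilityMeasure (walkLaw m k) := by
  have h2 : (2 : ℝ) ≤ (k : ℝ) + 2 := by simp
  have := walkStep_isProbabilityMeasure ((h.contDiff_middleJumps h2).continuous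
    |>.integrable_of_hasCompactSupport (hasCompactSupport_middleJumps h2))
    (h.middleJumps_nonneg h2) (by positivity) hk
  exact convPower.isProbabilityMeasure _ _

lemma norm_exp_neg_cosSymbol_le (h : IsStableDensity α M m) {s : SchwartzMap E ℂ}
    (hs : ∀ ξ, (Real.exp (-cosSymbol m ξ) : ℂ) =
      (Real.exp (-cosSymbol (largeJumps m) ξ) : ℂ) * s ξ) (ξ : E) :
    ‖(Real.exp (-cosSymbol m ξ) : ℂ)‖ ≤ ‖s ξ‖ := by
  rw [hs, norm_mul]
  refine mul_le_of_le_one_left (norm_nonneg _) ?_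
  rw [Complex.norm_real, Real.norm_of_nonneg (Real.exp_pos _).le, Real.exp_le_one_iff]
  linarith [cosSymbol_nonneg h.largeJumps_nonneg ξ]

variable [Nontrivial E]

instance (m : E → ℝ) (k : ℕ) : SFinite (walkLaw m k) := by
  unfold walkLaw
  infer_instance

lemma integral_middleJumps_le (h : IsStableDensity α M m) (hα0 : 0 < α) (hα1 : α < 1) (k : ℕ) :
    ∫ w, middleJumps m ((k : ℝ) + 2) w ≤ ∫ w, largeJumps m w := by
  have hk : (2 : ℝ) ≤ (k : ℝ) + 2 := by simp
  refine integral_mono ?_ (h.integrable_largeJumps hα0 hα1) (h.middleJumps_le _)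
  exact (h.contDiff_middleJumps hk).continuous.integrable_of_hasCompactSupport
    (hasCompactSupport_middleJumps hk)

lemma eventually_integral_middleJumps_le (h : IsStableDensity α M m) (hα0 : 0 < α)
    (hα1 : α < 1) : ∀ᶠ k : ℕ in atTop, ∫ w, middleJumps m ((k : ℝ) + 2) w ≤ (k : ℝ) + 1 := by
  obtain ⟨n, hn⟩ := exists_nat_ge (∫ w, largeJumps m w)
  filter_upwards [eventually_ge_atTop n] with k hk
  have : (n : ℝ) ≤ k := by exact_mod_cast hk
  linarith [h.integral_middleJumps_le hα0 hα1 k]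

lemma integrable_cosSymbol_of_le (h : IsStableDensity α M m) (hα0 : 0 < α) (hα1 : α < 1)
    {θ : E → ℝ} (hθ : Continuous θ) (hb : ∀ w, |θ w| ≤ 1) (ξ : E) :
    Integrable (fun w => (1 - Real.cos (2 * Real.pi * ⟪w, ξ⟫)) * (θ w * m w)) := by
  refine integrable_cosSymbol (hθ.aestronglyMeasurable.mul h.aestronglyMeasurable) ?_ ξ
  have h1 := (h.integrable_min_mul hα0 hα1).bdd_mul (c := 1) hθ.aestronglyMeasurable
    (.of_forall hb)
  exact h1.congr (.of_forall fun w => mul_left_comm _ _ _)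

lemma cosSymbol_middleJumps_tendsto (h : IsStableDensity α M m) (hα0 : 0 < α) (hα1 : α < 1)
    (ξ : E) :
    Tendsto (fun k : ℕ => cosSymbol (middleJumps m ((k : ℝ) + 2)) ξ) atTop
      (𝓝 (cosSymbol (largeJumps m) ξ)) := by
  refine tendsto_integral_of_dominated_convergence (fun w => 2 * largeJumps m w) (fun k => ?_)
    ((h.integrable_largeJumps hα0 hα1).const_mul 2) (fun k => .of_forall fun w => ?_)
    (.of_forall fun w => ?_)
  · refine Continuous.aestronglyMeasurable ?_
    have := (h.contDiff_middleJumps (R := (k : ℝ) + 2) (by simp)).continuous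
    fun_prop
  · have h0 := h.middleJumps_nonneg (R := (k : ℝ) + 2) (by simp) w
    rw [norm_mul, Real.norm_of_nonneg (one_sub_cos_inner_nonneg w ξ), Real.norm_of_nonneg h0]
    gcongr
    · linarith [Real.neg_one_le_cos (2 * Real.pi * ⟪w, ξ⟫)]
    · exact h.middleJumps_le _ w
  · refine tendsto_const_nhds.mul (tendsto_const_nhds.congr' ?_)
    obtain ⟨n, hn⟩ := exists_nat_ge ‖w‖
    filter_upwards [eventually_ge_atTop n] with k hk
    have : (n : ℝ) ≤ k := by exact_mod_cast hk
    rw [largeJumps, middleJumps, cutoff_eq_one (R := (k : ℝ) + 2) (by positivity) (by linarith)]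

/-- The compound Poisson limit `(1 - ψ_N / N) ^ N → exp (-ψ)` of the characteristic functions of the
walks. -/
lemma charFun_walkLaw_tendsto (h : IsStableDensity α M m) (hα0 : 0 < α) (hα1 : α < 1) (ξ : E) :
    Tendsto (fun k : ℕ => charFun (walkLaw m k) ((2 * Real.pi) • ξ)) atTop
      (𝓝 ((Real.exp (-cosSymbol (largeJumps m) ξ) : ℝ) : ℂ)) := by
  -- the index is shifted by one to meet the form of `Real.tendsto_one_add_pow_exp_of_tendsto`
  have h1 : Tendsto (fun k : ℕ => (k : ℝ) * (-(cosSymbol (middleJumps m (((k - 1 : ℕ) : ℝ) + 2)) ξ)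
      / (k : ℝ))) atTop (𝓝 (-cosSymbol (largeJumps m) ξ)) := by
    have h2 : Tendsto (fun k : ℕ => -(cosSymbol (middleJumps m (((k - 1 : ℕ) : ℝ) + 2)) ξ))
        atTop (𝓝 (-cosSymbol (largeJumps m) ξ)) :=
      ((h.cosSymbol_middleJumps_tendsto hα0 hα1 ξ).comp (tendsto_sub_atTop_nat 1)).neg
    refine h2.congr' ?_
    filter_upwards [eventually_gt_atTop 0] with k hk
    have : (k : ℝ) ≠ 0 := by positivity
    field_simp
  have h3 := (Real.tendsto_one_add_pow_exp_of_tendsto h1).comp (tendsto_add_atTop_nat 1)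
  have h4 := (Complex.continuous_ofReal.tendsto _).comp h3
  refine h4.congr' ?_
  filter_upwards [h.eventually_integral_middleJumps_le hα0 hα1] with k hk
  have h2 : (2 : ℝ) ≤ (k : ℝ) + 2 := by simp
  rw [walkLaw, charFun_walk (h.contDiff_middleJumps h2).continuous
    (hasCompactSupport_middleJumps h2) (h.middleJumps_nonneg h2) (h.even_middleJumps _) k hk]
  simp

/-- The symbol is the sum of those of the small and of the large jumps. -/
lemma cosSymbol_eq_add (h : IsStableDensity α M m) (hα0 : 0 < α) (hα1 : α < 1) (ξ : E) :
    cosSymbol m ξ = cosSymbol (fun w => cutoff 1 w * m w) ξ + cosSymbol (largeJumps m) ξ := by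
  rw [cosSymbol, cosSymbol, cosSymbol, ← integral_add]
  · refine integral_congr_ae (.of_forall fun w => ?_)
    simp only [largeJumps]; ring
  · refine h.integrable_cosSymbol_of_le hα0 hα1 (contDiff_cutoff 1).continuous (fun w => ?_) ξ
    rw [abs_of_nonneg (cutoff_nonneg 1 w)]; exact cutoff_le_one 1 w
  · refine h.integrable_cosSymbol_of_le hα0 hα1 (θ := fun w => 1 - cutoff 1 w)
      (continuous_const.sub (contDiff_cutoff 1).continuous) (fun w => ?_) ξ
    rw [abs_le]
    constructor <;> linarith [cutoff_nonneg 1 w, cutoff_le_one 1 w]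

lemma cosSymbol_largeJumps_le (h : IsStableDensity α M m) (hα0 : 0 < α) (hα1 : α < 1) (ξ : E) :
    cosSymbol (largeJumps m) ξ ≤ 2 * ∫ w, largeJumps m w := by
  rw [← integral_const_mul]
  refine integral_mono_of_nonneg
    (.of_forall fun w => mul_nonneg (one_sub_cos_inner_nonneg w ξ) (h.largeJumps_nonneg w))
    ((h.integrable_largeJumps hα0 hα1).const_mul 2) (.of_forall fun w => ?_)
  have := h.largeJumps_nonneg w
  simp only
  gcongr
  linarith [Real.neg_one_le_cos (2 * Real.pi * ⟪w, ξ⟫)]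

lemma continuous_cosSymbol_largeJumps (h : IsStableDensity α M m) (hα0 : 0 < α) (hα1 : α < 1) :
    Continuous (cosSymbol (largeJumps m)) := by
  refine continuous_of_dominated (bound := fun w => 2 * largeJumps m w) (fun ξ => ?_)
    (fun ξ => .of_forall fun w => ?_) ((h.integrable_largeJumps hα0 hα1).const_mul 2)
    (.of_forall fun w => by fun_prop)
  · exact AEStronglyMeasurable.mul (Continuous.aestronglyMeasurable (by fun_prop))
      (h.integrable_largeJumps hα0 hα1).1
  · rw [norm_mul, Real.norm_of_nonneg (one_sub_cos_inner_nonneg w ξ),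
      Real.norm_of_nonneg (h.largeJumps_nonneg w)]
    have := h.largeJumps_nonneg w
    gcongr
    linarith [Real.neg_one_le_cos (2 * Real.pi * ⟪w, ξ⟫)]

/-- The factorisation of `exp (-ψ)` on which the estimates rest: the contribution of the small
jumps is a Schwartz function, that of the large jumps is bounded. -/
lemma exists_schwartzMap_mul_exp (h : IsStableDensity α M m) (hα0 : 0 < α) (hα1 : α < 1)
    {c : ℝ} (hc : 0 < c) (hlow : ∀ ξ, c * ‖ξ‖ ^ α ≤ cosSymbol m ξ) :
    ∃ s : SchwartzMap E ℂ, ∀ ξ, (Real.exp (-cosSymbol m ξ) : ℂ) =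
      (Real.exp (-cosSymbol (largeJumps m) ξ) : ℂ) * s ξ := by
  obtain ⟨hcd, hb⟩ := contDiff_cosSymbol_and_bounded (k := fun w => cutoff 1 w * m w)
    ((contDiff_cutoff 1).continuous.aestronglyMeasurable.mul h.aestronglyMeasurable)
    (h.integrable_pow_mul_small hα0 hα1)
  obtain ⟨s, hs⟩ := exists_schwartzMap_exp_neg hcd hb (A := 2 * ∫ w, largeJumps m w) hc hα0
    (fun ξ => by
      have := hlow ξ
      rw [h.cosSymbol_eq_add hα0 hα1 ξ] at this
      linarith [h.cosSymbol_largeJumps_le hα0 hα1 ξ])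
  refine ⟨s, fun ξ => ?_⟩
  rw [hs, ← Complex.ofReal_mul, ← Real.exp_add, h.cosSymbol_eq_add hα0 hα1 ξ]
  congr 2
  ring

end IsStableDensity

end Core

/-! ### The Fourier transform of `exp (-ψ)` and its derivatives -/

section Derivatives

open scoped RealInnerProductSpace FourierTransform Topology
open Filter

variable {E : Type*} [NormedAddCommGroup E] [InnerProductSpace ℝ E] [FiniteDimensional ℝ E]
  [MeasurableSpace E] [BorelSpace E]

lemma lintegral_enorm_lt_top_iff_of_continuous {V : Type*} [NormedAddCommGroup V] {f : E → V}
    (hf : Continuous f) : ∫⁻ y, ‖f y‖ₑ < ⊤ ↔ Integrable f :=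
  ⟨fun h => ⟨hf.aestronglyMeasurable, h⟩, fun h => h.2⟩

/-- The weighted `L¹` estimate for the gradient of `Q` convolved with the law of the walk, with a
constant that does not depend on the walk. -/
theorem IsStableDensity.exists_lintegral_weight_fderiv_walkLaw_le [Nontrivial E] {α M : ℝ}
    {m : E → ℝ} (h : IsStableDensity α M m) (hα0 : 0 < α) (hα1 : α < 1)
    {V : Type*} [NormedAddCommGroup V] [NormedSpace ℝ V] [CompleteSpace V] {Q : E → V}
    (hQ : ContDiff ℝ 1 Q) {B : ℝ} (hB : ∀ x, ‖fderiv ℝ Q x‖ ≤ B) (hQi : Integrable Q)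
    (hQ1' : Integrable fun y => ‖fderiv ℝ Q y‖) (hQw : Integrable fun y => ‖y‖ * ‖fderiv ℝ Q y‖) :
    ∃ C : ENNReal, C ≠ ⊤ ∧ ∀ᶠ k in atTop,
      ∫⁻ y, (1 + ‖y‖ₑ) * ‖∫ z, fderiv ℝ Q (y - z) ∂(walkLaw m k)‖ₑ ≤ C := by
  obtain ⟨C₀, hC₀, hmid⟩ := h.exists_lintegral_fderiv_mul_middleJumps_le hα0 hα1
  set e := stdOrthonormalBasis ℝ E
  have hDc : Continuous (fderiv ℝ Q) := hQ.continuous_fderiv (by simp)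
  have hQ1 : Integrable (fderiv ℝ Q) := (integrable_norm_iff hDc.aestronglyMeasurable).1 hQ1'
  have hwi : ∀ i l, ∫⁻ y, ‖innerSL ℝ (e l) y‖ₑ * ‖fderiv ℝ Q y (e i)‖ₑ ≠ ⊤ := by
    intro i l
    refine ne_of_lt ?_
    have h1 : Integrable (fun y => innerSL ℝ (e l) y • fderiv ℝ Q y (e i)) := by
      refine hQw.mono'
        (Continuous.aestronglyMeasurable (by fun_prop)) (.of_forall fun y => ?_)
      rw [norm_smul]
      refine mul_le_mul ?_ ?_ (norm_nonneg _) (norm_nonneg _)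
      · refine (norm_inner_le_norm _ _).trans ?_
        rw [e.norm_eq_one, one_mul]
      · refine (ContinuousLinearMap.le_opNorm _ _).trans ?_
        rw [e.norm_eq_one, mul_one]
    have h2 := h1.2
    rw [HasFiniteIntegral] at h2
    simpa only [enorm_smul] using h2
  refine ⟨(∫⁻ y, ‖fderiv ℝ Q y‖ₑ) + ∑ l, ∑ i,
    ((∫⁻ y, ‖innerSL ℝ (e l) y‖ₑ * ‖fderiv ℝ Q y (e i)‖ₑ) + C₀ * ∫⁻ y, ‖Q y‖ₑ), ?_, ?_⟩
  · refine ENNReal.add_ne_top.2 ⟨hQ1.2.ne, ?_⟩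
    refine (ENNReal.sum_lt_top.2 fun l _ => ENNReal.sum_lt_top.2 fun i _ => ?_).ne
    exact ENNReal.add_lt_top.2 ⟨(hwi i l).lt_top, ENNReal.mul_lt_top hC₀.lt_top hQi.2⟩
  filter_upwards [h.eventually_integral_middleJumps_le hα0 hα1] with k hk
  have hR : (2 : ℝ) ≤ (k : ℝ) + 2 := by simp
  have := h.isProbabilityMeasure_walkLaw hk
  have hDint : ∀ y, Integrable (fun z => fderiv ℝ Q (y - z)) (walkLaw m k) := fun y =>
    Integrable.of_bound (C := B) (by fun_prop) (.of_forall fun z => hB _)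
  have hJle : ∀ y, ‖∫ z, fderiv ℝ Q (y - z) ∂(walkLaw m k)‖ₑ ≤
      ∑ i, ‖∫ z, fderiv ℝ Q (y - z) (e i) ∂(walkLaw m k)‖ₑ := by
    intro y
    refine (enorm_le_sum_enorm_apply_basis e _).trans (le_of_eq ?_)
    refine Finset.sum_congr rfl fun i _ => ?_
    rw [ContinuousLinearMap.integral_apply (hDint y)]
  have hJm : ∀ i, Measurable fun y => ‖∫ z, fderiv ℝ Q (y - z) (e i) ∂(walkLaw m k)‖ₑ := by
    intro i
    refine StronglyMeasurable.enorm ?_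
    exact StronglyMeasurable.integral_prod_right'
      (f := fun p : E × E => fderiv ℝ Q (p.1 - p.2) (e i))
      (Continuous.stronglyMeasurable (by fun_prop))
  have hJm0 : Measurable fun y => ‖∫ z, fderiv ℝ Q (y - z) ∂(walkLaw m k)‖ₑ := by
    refine StronglyMeasurable.enorm ?_
    exact StronglyMeasurable.integral_prod_right' (f := fun p : E × E => fderiv ℝ Q (p.1 - p.2))
      (Continuous.stronglyMeasurable (by fun_prop))
  simp_rw [add_mul, one_mul]
  rw [lintegral_add_left hJm0]
  refine add_le_add (lintegral_enorm_integral_sub_le _ hDc) ?_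
  calc ∫⁻ y, ‖y‖ₑ * ‖∫ z, fderiv ℝ Q (y - z) ∂(walkLaw m k)‖ₑ
      ≤ ∫⁻ y, ∑ l, ∑ i, ‖innerSL ℝ (e l) y‖ₑ *
          ‖∫ z, fderiv ℝ Q (y - z) (e i) ∂(walkLaw m k)‖ₑ := by
        refine lintegral_mono fun y => ?_
        refine (mul_le_mul' (enorm_le_sum_enorm_inner_basis e y) (hJle y)).trans (le_of_eq ?_)
        rw [Finset.sum_mul_sum]
    _ = ∑ l, ∑ i, ∫⁻ y, ‖innerSL ℝ (e l) y‖ₑ *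
          ‖∫ z, fderiv ℝ Q (y - z) (e i) ∂(walkLaw m k)‖ₑ := by
        have hm : ∀ l i, Measurable fun y => ‖innerSL ℝ (e l) y‖ₑ *
            ‖∫ z, fderiv ℝ Q (y - z) (e i) ∂(walkLaw m k)‖ₑ := fun l i =>
          (innerSL ℝ (e l)).continuous.measurable.enorm.mul (hJm i)
        rw [lintegral_finsetSum _ fun l _ => Finset.measurable_sum _ fun i _ => hm l i]
        exact Finset.sum_congr rfl fun l _ => lintegral_finsetSum _ fun i _ => hm l i
    _ ≤ _ := by
        refine Finset.sum_le_sum fun l _ => Finset.sum_le_sum fun i _ => ?_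
        refine (lintegral_weight_fderiv_walk_le (h.contDiff_middleJumps hR)
          (hasCompactSupport_middleJumps hR) (h.middleJumps_nonneg hR) k hk hQ hB
          (innerSL ℝ (e l)) (e i)).trans ?_
        gcongr
        refine hmid _ hR _ _ ?_ (e.norm_eq_one i).le
        rw [innerSL_apply_norm, e.norm_eq_one]

namespace IsStableDensity

variable {α M : ℝ} {m : E → ℝ}

lemma norm_exp_largeJumps_smul_le (h : IsStableDensity α M m) {V : Type*} [NormedAddCommGroup V]
    [NormedSpace ℂ V] (a : E → V) (v : E) :
    ‖((Real.exp (-cosSymbol (largeJumps m) v) : ℝ) : ℂ) • a v‖ ≤ ‖a v‖ := by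
  rw [norm_smul]
  refine mul_le_of_le_one_left (norm_nonneg _) ?_
  rw [Complex.norm_real, Real.norm_of_nonneg (Real.exp_pos _).le, Real.exp_le_one_iff]
  linarith [cosSymbol_nonneg h.largeJumps_nonneg v]

variable [Nontrivial E]

/-- Convolving with the laws of the walks amounts, in the limit, to multiplying the transformed
function by the contribution of the large jumps to `exp (-ψ)`. -/
lemma tendsto_integral_fourier_walkLaw (h : IsStableDensity α M m) (hα0 : 0 < α) (hα1 : α < 1)
    {V : Type*} [NormedAddCommGroup V] [NormedSpace ℂ V] [CompleteSpace V] {a : E → V}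
    (ha : Integrable a) (y : E) :
    Tendsto (fun k => ∫ z, 𝓕 a (y - z) ∂(walkLaw m k)) atTop
      (𝓝 (𝓕 (fun v => ((Real.exp (-cosSymbol (largeJumps m) v) : ℝ) : ℂ) • a v) y)) := by
  have hK : ∀ᶠ k in atTop, IsProbabilityMeasure (walkLaw m k) := by
    filter_upwards [h.eventually_integral_middleJumps_le hα0 hα1] with k hk
    exact h.isProbabilityMeasure_walkLaw hk
  have hconv : Tendsto (fun k => ∫ v, 𝐞 (-⟪v, y⟫) •
      charFun (walkLaw m k) ((2 * Real.pi) • v) • a v) atTop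
      (𝓝 (∫ v, 𝐞 (-⟪v, y⟫) •
        ((Real.exp (-cosSymbol (largeJumps m) v) : ℝ) : ℂ) • a v)) := by
    refine tendsto_integral_filter_of_dominated_convergence (fun v => ‖a v‖) ?_ ?_ ha.norm ?_
    · filter_upwards [hK] with k hk
      refine AEStronglyMeasurable.fun_smul (Continuous.aestronglyMeasurable (by fun_prop)) ?_
      refine AEStronglyMeasurable.fun_smul ?_ ha.1
      exact (measurable_charFun.comp (by fun_prop)).aestronglyMeasurable
    · filter_upwards [hK] with k hk
      refine .of_forall fun v => ?_
      rw [Circle.norm_smul, norm_smul]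
      exact mul_le_of_le_one_left (norm_nonneg _) (norm_charFun_le_one _)
    · refine .of_forall fun v => ?_
      exact ((h.charFun_walkLaw_tendsto hα0 hα1 v).smul_const (a v)).const_smul (𝐞 (-⟪v, y⟫))
  refine hconv.congr' ?_
  filter_upwards [hK] with k hk
  rw [integral_fourier_sub _ ha]

/-- Let `a` be such that its Fourier transform and the gradient of the latter decay well. After
multiplication of `a` by the contribution of the large jumps to `exp (-ψ)`, the gradient of the
Fourier transform still has a finite first absolute moment. -/
theorem integrable_weight_fderiv_fourier (h : IsStableDensity α M m) (hα0 : 0 < α) (hα1 : α < 1)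
    {V : Type*} [NormedAddCommGroup V] [NormedSpace ℂ V] [CompleteSpace V] {a : E → V}
    (ha : Integrable a) (ha1 : Integrable fun v => ‖v‖ * ‖a v‖)
    (hQ : ContDiff ℝ 1 (𝓕 a)) {B : ℝ} (hB : ∀ x, ‖fderiv ℝ (𝓕 a) x‖ ≤ B)
    (hQi : Integrable (𝓕 a)) (hQ1 : Integrable fun y => ‖fderiv ℝ (𝓕 a) y‖)
    (hQw : Integrable fun y => ‖y‖ * ‖fderiv ℝ (𝓕 a) y‖) :
    Integrable fun y => (1 + ‖y‖) *
      ‖fderiv ℝ (𝓕 fun v => ((Real.exp (-cosSymbol (largeJumps m) v) : ℝ) : ℂ) • a v) y‖ := by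
  set χ : E → ℂ := fun v => ((Real.exp (-cosSymbol (largeJumps m) v) : ℝ) : ℂ) with hχ
  have hχc : Continuous χ := Complex.continuous_ofReal.comp
    (Real.continuous_exp.comp (h.continuous_cosSymbol_largeJumps hα0 hα1).neg)
  set b : E → V := fun v => χ v • a v with hb
  have hbm : AEStronglyMeasurable b := hχc.aestronglyMeasurable.smul ha.1
  have hbi : Integrable b :=
    ha.norm.mono' hbm (.of_forall fun v => h.norm_exp_largeJumps_smul_le a v)
  have hb1 : Integrable fun v => ‖v‖ * ‖b v‖ := by
    refine ha1.mono' ((Continuous.aestronglyMeasurable (by fun_prop)).mul hbm.norm)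
      (.of_forall fun v => ?_)
    rw [norm_mul, norm_norm, norm_norm]
    gcongr
    exact h.norm_exp_largeJumps_smul_le a v
  set a' : E → (E →L[ℝ] V) := VectorFourier.fourierSMulRight (innerSL ℝ) a with ha'
  have hfa : fderiv ℝ (𝓕 a) = 𝓕 a' := Real.fderiv_fourier ha ha1
  have hfb : fderiv ℝ (𝓕 b) = 𝓕 (fun v => χ v • a' v) := by
    rw [Real.fderiv_fourier hbi hb1]
    congr 1
    funext v
    ext x
    simp only [ha', hb, VectorFourier.fourierSMulRight_apply, smul_apply]
    rw [smul_comm (χ v), smul_comm (χ v)]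
  have ha'i : Integrable a' := by
    refine (ha1.const_mul (2 * Real.pi)).mono' ha.1.fourierSMulRight (.of_forall fun v => ?_)
    rw [ha', VectorFourier.norm_fourierSMulRight, innerSL_apply_norm, mul_assoc]
  have hfbc : Continuous (fderiv ℝ (𝓕 b)) := by
    rw [hfb]
    refine VectorFourier.fourierIntegral_continuous Real.continuous_fourierChar
      continuous_inner ?_
    exact ha'i.norm.mono' (hχc.aestronglyMeasurable.smul ha'i.1)
      (.of_forall fun v => h.norm_exp_largeJumps_smul_le a' v)
  rw [← lintegral_enorm_lt_top_iff_of_continuous (by fun_prop)]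
  obtain ⟨C, hC, hle⟩ := h.exists_lintegral_weight_fderiv_walkLaw_le hα0 hα1 hQ hB hQi hQ1 hQw
  refine lt_of_le_of_lt ?_ hC.lt_top
  have h1 : ∀ y, ‖(1 + ‖y‖) * ‖fderiv ℝ (𝓕 b) y‖‖ₑ = (1 + ‖y‖ₑ) * ‖𝓕 (fun v => χ v • a' v) y‖ₑ :=
    fun y => by
      rw [enorm_mul, enorm_norm, Real.enorm_of_nonneg (by positivity),
        ENNReal.ofReal_add zero_le_one (norm_nonneg _), ofReal_norm, ENNReal.ofReal_one, hfb]
  simp_rw [h1]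
  rw [hfa] at hle
  have hQ'c : Continuous (𝓕 a') := hfa ▸ hQ.continuous_fderiv (by simp)
  refine lintegral_le_of_tendsto (fun k => ?_) (fun y => ?_) hle
  · refine (measurable_const.add measurable_enorm).mul (StronglyMeasurable.enorm ?_)
    exact StronglyMeasurable.integral_prod_right' (f := fun p : E × E => 𝓕 a' (p.1 - p.2))
      (Continuous.stronglyMeasurable (by fun_prop))
  · refine ENNReal.Tendsto.const_mul
      (h.tendsto_integral_fourier_walkLaw hα0 hα1 ha'i y).enorm (.inr ?_)
    simp

/-- The Fourier transform of `exp (-ψ)` is smooth and integrable, and its derivatives of positive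
order stay integrable when multiplied by `1 + ‖y‖`. -/
theorem fourier_exp_neg_cosSymbol (h : IsStableDensity α M m) (hα0 : 0 < α) (hα1 : α < 1)
    {c : ℝ} (hc : 0 < c) (hlow : ∀ ξ, c * ‖ξ‖ ^ α ≤ cosSymbol m ξ)
    (hcont : Continuous (cosSymbol m)) :
    Integrable (fun ξ => (Real.exp (-cosSymbol m ξ) : ℂ)) ∧
    ContDiff ℝ ∞ (𝓕 fun ξ => (Real.exp (-cosSymbol m ξ) : ℂ)) ∧
    Integrable (𝓕 fun ξ => (Real.exp (-cosSymbol m ξ) : ℂ)) ∧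
    ∀ j : ℕ, Integrable fun y => (1 + ‖y‖) *
      ‖iteratedFDeriv ℝ (j + 1) (𝓕 fun ξ => (Real.exp (-cosSymbol m ξ) : ℂ)) y‖ := by
  obtain ⟨s, hs⟩ := h.exists_schwartzMap_mul_exp hα0 hα1 hc hlow
  set f : E → ℂ := fun ξ => (Real.exp (-cosSymbol m ξ) : ℂ) with hf
  have hfc : Continuous f := by
    refine Complex.continuous_ofReal.comp (Real.continuous_exp.comp hcont.neg)
  have hfs : ∀ ξ, ‖f ξ‖ ≤ ‖s ξ‖ := h.norm_exp_neg_cosSymbol_le hs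
  have hsi : ∀ n : ℕ, Integrable (fun ξ => ‖ξ‖ ^ n * ‖s ξ‖) := fun n =>
    s.integrable_pow_mul volume n
  have hfi : ∀ n : ℕ, Integrable (fun ξ => ‖ξ‖ ^ n * ‖f ξ‖) := by
    intro n
    refine (hsi n).mono' (Continuous.aestronglyMeasurable (by fun_prop)) (.of_forall fun ξ => ?_)
    rw [norm_mul, norm_norm, norm_pow, norm_norm]
    gcongr
    exact hfs ξ
  have hfi0 : Integrable f := (integrable_norm_iff hfc.aestronglyMeasurable).1
    (by simpa using hfi 0)
  have hcd : ContDiff ℝ ∞ (𝓕 f) := Real.contDiff_fourier (N := ⊤) fun n _ => hfi n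
  set q : SchwartzMap E ℂ := 𝓕 s with hq
  have hqs : (q : E → ℂ) = 𝓕 (s : E → ℂ) := SchwartzMap.fourier_coe s
  refine ⟨hfi0, hcd, ?_, fun j => ?_⟩
  · rw [← lintegral_enorm_lt_top_iff_of_continuous hcd.continuous]
    refine lt_of_le_of_lt ?_ (q.integrable (μ := volume)).2
    have hlim := fun y =>
      (h.tendsto_integral_fourier_walkLaw hα0 hα1 (s.integrable (μ := volume)) y).enorm
    have hfe : f = fun v => ((Real.exp (-cosSymbol (largeJumps m) v) : ℝ) : ℂ) • s v :=
      funext hs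
    rw [hfe]
    rw [← hqs] at hlim
    refine lintegral_le_of_tendsto (fun k => ?_) hlim ?_
    · refine StronglyMeasurable.enorm ?_
      exact StronglyMeasurable.integral_prod_right' (f := fun p : E × E => q (p.1 - p.2))
        (Continuous.stronglyMeasurable (by fun_prop))
    · filter_upwards [h.eventually_integral_middleJumps_le hα0 hα1] with k hk
      have := h.isProbabilityMeasure_walkLaw hk
      exact lintegral_enorm_integral_sub_le _ q.continuous
  · -- the `j`-th derivative is again a Fourier transform, to which the first-order result applies
    set a : E → (E [×j]→L[ℝ] ℂ) :=
      fun v => VectorFourier.fourierPowSMulRight (innerSL ℝ) s v j with ha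
    have ham : AEStronglyMeasurable a := s.continuous.aestronglyMeasurable.fourierPowSMulRight _ j
    have hai : Integrable a :=
      VectorFourier.integrable_fourierPowSMulRight _ (hsi j) s.continuous.aestronglyMeasurable
    have ha1 : Integrable fun v => ‖v‖ * ‖a v‖ := by
      refine ((hsi (j + 1)).const_mul ((2 * Real.pi * ‖innerSL ℝ (E := E)‖) ^ j)).mono'
        ((Continuous.aestronglyMeasurable (by fun_prop)).mul ham.norm) (.of_forall fun v => ?_)
      rw [norm_mul, norm_norm, norm_norm]
      calc ‖v‖ * ‖a v‖ ≤ ‖v‖ * ((2 * Real.pi * ‖innerSL ℝ (E := E)‖) ^ j * ‖v‖ ^ j * ‖s v‖) := by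
            gcongr
            exact VectorFourier.norm_fourierPowSMulRight_le _ _ _ _
        _ = _ := by ring
    have hqa : iteratedFDeriv ℝ j q = 𝓕 a := by
      rw [hqs, Real.iteratedFDeriv_fourier (N := ⊤) (fun n _ => hsi n)
        s.continuous.aestronglyMeasurable le_top]
    have hfa : iteratedFDeriv ℝ j (𝓕 f) =
        𝓕 (fun v => ((Real.exp (-cosSymbol (largeJumps m) v) : ℝ) : ℂ) • a v) := by
      rw [Real.iteratedFDeriv_fourier (N := ⊤) (fun n _ => hfi n)
        hfc.aestronglyMeasurable le_top]
      congr 1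
      funext v
      ext x
      simp only [ha, VectorFourier.fourierPowSMulRight_apply, smul_apply, hf, hs]
      rw [smul_comm _ _ (s v), smul_eq_mul, smul_eq_mul, smul_eq_mul]
      simp only [Complex.real_smul]
      ring
    have hDn : ∀ x, ‖fderiv ℝ (𝓕 a) x‖ = ‖iteratedFDeriv ℝ (j + 1) q x‖ := fun x => by
      rw [← hqa]; exact norm_fderiv_iteratedFDeriv
    have hQ : ContDiff ℝ 1 (𝓕 a) := by
      rw [← hqa]
      exact (q.smooth (j + 1)).iteratedFDeriv_right (by norm_cast; omega)
    obtain ⟨B, -, hB⟩ := q.decay 0 (j + 1)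
    have key := h.integrable_weight_fderiv_fourier hα0 hα1 hai ha1 hQ (B := B)
      (fun x => by rw [hDn]; simpa using hB x) ?_ ?_ ?_
    · rw [← hfa] at key
      simp_rw [norm_fderiv_iteratedFDeriv] at key
      exact key
    · refine (integrable_norm_iff hQ.continuous.aestronglyMeasurable).1 ?_
      rw [← hqa]
      simpa using q.integrable_pow_mul_iteratedFDeriv volume 0 j
    · simp_rw [hDn]
      simpa using q.integrable_pow_mul_iteratedFDeriv volume 0 (j + 1)
    · simp_rw [hDn]
      simpa using q.integrable_pow_mul_iteratedFDeriv volume 1 (j + 1)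

end IsStableDensity

end Derivatives

/-! ### Polar coordinates and the density of a stable Lévy measure -/

section Polar

open scoped Pointwise

variable {n : ℕ}

lemma finrank_eucl (n : ℕ) : Module.finrank ℝ (Eucl n) = n + 1 := finrank_euclideanSpace_fin

/-- The direction `y / ‖y‖` of a nonzero vector, as a point of the sphere. -/
def unitDirection (y : Eucl n) (hy : y ≠ 0) : USphere n :=
  ⟨‖y‖⁻¹ • y, by rw [mem_sphere_zero_iff_norm, norm_smul, norm_inv, norm_norm,
    inv_mul_cancel₀ (norm_ne_zero_iff.2 hy)]⟩

lemma unitDirection_smul {r : ℝ} (hr : 0 < r) (s : USphere n)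
    (h : r • (s : Eucl n) ≠ 0) : unitDirection (r • (s : Eucl n)) h = s := by
  apply Subtype.ext
  have hs : ‖(s : Eucl n)‖ = 1 := mem_sphere_zero_iff_norm.1 s.2
  simp only [unitDirection]
  rw [norm_smul, hs, mul_one, Real.norm_of_nonneg hr.le, smul_smul, inv_mul_cancel₀ hr.ne',
    one_smul]

/-- The density with respect to Lebesgue measure of the stable Lévy measure whose spherical part
has density `f` with respect to the surface measure, with the value `0` at the origin. -/
def stableDensity (α : ℝ) (f : USphere n → ℝ) (y : Eucl n) : ℝ :=
  if hy : y = 0 then 0 else ‖y‖ ^ (-((n + 1 : ℕ) : ℝ) - α) * f (unitDirection y hy)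

lemma stableDensity_of_ne_zero {α : ℝ} {f : USphere n → ℝ} {y : Eucl n} (hy : y ≠ 0) :
    stableDensity α f y = ‖y‖ ^ (-((n + 1 : ℕ) : ℝ) - α) * f (unitDirection y hy) :=
  dif_neg hy

lemma smul_sphere_ne_zero {r : ℝ} (hr : 0 < r) (s : USphere n) : r • (s : Eucl n) ≠ 0 := by
  have hs : ‖(s : Eucl n)‖ = 1 := mem_sphere_zero_iff_norm.1 s.2
  rw [← norm_ne_zero_iff, norm_smul, hs, mul_one, Real.norm_of_nonneg hr.le]
  exact hr.ne'

lemma stableDensity_smul_sphere {α : ℝ} {f : USphere n → ℝ} {r : ℝ} (hr : 0 < r)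
    (s : USphere n) :
    stableDensity α f (r • (s : Eucl n)) = r ^ (-((n + 1 : ℕ) : ℝ) - α) * f s := by
  have hs : ‖(s : Eucl n)‖ = 1 := mem_sphere_zero_iff_norm.1 s.2
  rw [stableDensity_of_ne_zero (smul_sphere_ne_zero hr s), unitDirection_smul hr, norm_smul, hs,
    mul_one, Real.norm_of_nonneg hr.le]

lemma stableDensity_smul {α : ℝ} {f : USphere n → ℝ} {r : ℝ} (hr : 0 < r) (y : Eucl n) :
    stableDensity α f (r • y) = r ^ (-((n + 1 : ℕ) : ℝ) - α) * stableDensity α f y := by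
  rcases eq_or_ne y 0 with rfl | hy
  · simp [stableDensity]
  · have hy' : 0 < ‖y‖ := norm_pos_iff.2 hy
    have h1 : y = ‖y‖ • (unitDirection y hy : Eucl n) := by
      simp only [unitDirection]
      rw [smul_smul, mul_inv_cancel₀ hy'.ne', one_smul]
    rw [h1, smul_smul, stableDensity_smul_sphere (mul_pos hr hy'), stableDensity_smul_sphere hy',
      Real.mul_rpow hr.le hy'.le, mul_assoc]

lemma stableDensity_nonneg {α : ℝ} {f : USphere n → ℝ} (hf : ∀ s, 0 ≤ f s) (y : Eucl n) :
    0 ≤ stableDensity α f y := by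
  unfold stableDensity
  split_ifs with h
  · exact le_rfl
  · exact mul_nonneg (by positivity) (hf _)

lemma stableDensity_neg {α : ℝ} {f : USphere n → ℝ} (hf : ∀ s, f (-s) = f s) (y : Eucl n) :
    stableDensity α f (-y) = stableDensity α f y := by
  rcases eq_or_ne y 0 with rfl | hy
  · simp
  · have hd : unitDirection (-y) (neg_ne_zero.2 hy) = -unitDirection y hy := by
      apply Subtype.ext
      simp [unitDirection]
    rw [stableDensity_of_ne_zero hy, stableDensity_of_ne_zero (neg_ne_zero.2 hy), hd, hf, norm_neg]

/-- A smooth function on the sphere, extended to be homogeneous of degree `-d - α`, is smooth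
away from the origin. -/
lemma contDiffAt_stableDensity {α : ℝ} {f : USphere n → ℝ} (hf : ContMDiff (𝓡 n) 𝓘(ℝ, ℝ) ∞ f)
    {y : Eucl n} (hy : y ≠ 0) : ContDiffAt ℝ ∞ (stableDensity α f) y := by
  set U : TopologicalSpace.Opens (Eucl n) := ⟨{0}ᶜ, isOpen_compl_singleton⟩
  have hU : ∀ x : U, (x : Eucl n) ≠ 0 := fun x => x.2
  have hcoe : ContMDiff 𝓘(ℝ, Eucl n) 𝓘(ℝ, Eucl n) ∞ (fun x : U => (x : Eucl n)) :=
    contMDiff_subtype_val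
  have hpow : ∀ p : ℝ, ContMDiff 𝓘(ℝ, Eucl n) 𝓘(ℝ, ℝ) ∞ (fun x : U => ‖(x : Eucl n)‖ ^ p) := by
    intro p x
    have h1 : ContDiffAt ℝ ∞ (fun y : Eucl n => ‖y‖ ^ p) (x : Eucl n) :=
      (contDiffAt_norm ℝ (hU x)).rpow_const_of_ne (norm_ne_zero_iff.2 (hU x))
    exact h1.contMDiffAt.comp x (hcoe x)
  have hdir : ContMDiff 𝓘(ℝ, Eucl n) 𝓘(ℝ, Eucl n) ∞
      (fun x : U => ‖(x : Eucl n)‖⁻¹ • (x : Eucl n)) := by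
    have h1 := (hpow (-1)).smul hcoe
    refine h1.congr fun x => ?_
    simp [Real.rpow_neg_one]
  have hdir' : ContMDiff 𝓘(ℝ, Eucl n) (𝓡 n) ∞
      (fun x : U => unitDirection (x : Eucl n) (hU x)) :=
    have : Fact (Module.finrank ℝ (Eucl n) = n + 1) := ⟨finrank_eucl n⟩
    hdir.codRestrict_sphere fun x => (unitDirection (x : Eucl n) (hU x)).2
  have hprod : ContMDiff 𝓘(ℝ, Eucl n) 𝓘(ℝ, ℝ) ∞
      (fun x : U => stableDensity α f (x : Eucl n)) := by
    have h1 := (hpow (-((n + 1 : ℕ) : ℝ) - α)).mul (hf.comp hdir')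
    exact h1.congr fun x => stableDensity_of_ne_zero (hU x)
  have := hprod ⟨y, hy⟩
  rw [contMDiffAt_subtype_iff (f := stableDensity α f)] at this
  exact this.contDiffAt

lemma measurable_stableDensity {α : ℝ} {f : USphere n → ℝ}
    (hf : ContMDiff (𝓡 n) 𝓘(ℝ, ℝ) ∞ f) : Measurable (stableDensity α f) :=
  measurable_of_continuousOn_compl_singleton 0 fun _ hy =>
    (contDiffAt_stableDensity hf hy).continuousAt.continuousWithinAt

/-- The bounds on the density and its gradient hold on the sphere by compactness, and everywhere by
homogeneity. -/
theorem exists_isStableDensity {α : ℝ} {f : USphere n → ℝ}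
    (hf : ContMDiff (𝓡 n) 𝓘(ℝ, ℝ) ∞ f) (hf0 : ∀ s, 0 ≤ f s) (hfe : ∀ s, f (-s) = f s) :
    ∃ M, IsStableDensity α M (stableDensity α f) := by
  have hcomp : IsCompact (Metric.sphere (0 : Eucl n) 1) := isCompact_sphere 0 1
  have hne : ∀ y ∈ Metric.sphere (0 : Eucl n) 1, y ≠ 0 := by
    rintro y hy rfl
    simp at hy
  have h1 : ContinuousOn (fun y => stableDensity α f y) (Metric.sphere (0 : Eucl n) 1) :=
    fun y hy => (contDiffAt_stableDensity hf (hne y hy)).continuousAt.continuousWithinAt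
  have h2 : ContinuousOn (fderiv ℝ (stableDensity α f)) (Metric.sphere (0 : Eucl n) 1) :=
    fun y hy => ((contDiffAt_stableDensity hf (hne y hy)).fderiv_right (m := 0)
      (by simp)).continuousAt.continuousWithinAt
  obtain ⟨M₁, hM₁⟩ := hcomp.exists_bound_of_continuousOn h1
  obtain ⟨M₂, hM₂⟩ := hcomp.exists_bound_of_continuousOn h2
  have hscale : ∀ (y : Eucl n) (hy : y ≠ 0), y = ‖y‖ • (unitDirection y hy : Eucl n) := by
    intro y hy
    simp only [unitDirection]
    rw [smul_smul, mul_inv_cancel₀ (norm_ne_zero_iff.2 hy), one_smul]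
  refine ⟨max 0 (max M₁ M₂), stableDensity_nonneg hf0,
    fun y hy => (contDiffAt_stableDensity hf hy).of_le (by simp), le_max_left _ _,
    fun y hy => ?_, fun y hy => ?_, .of_forall (stableDensity_neg hfe)⟩
  · have hy' : 0 < ‖y‖ := norm_pos_iff.2 hy
    rw [finrank_eucl]
    have h3 : stableDensity α f y = ‖y‖ ^ (-((n + 1 : ℕ) : ℝ) - α) *
        stableDensity α f (unitDirection y hy : Eucl n) := by
      conv_lhs => rw [hscale y hy]
      rw [stableDensity_smul hy']
    rw [h3, mul_comm]
    gcongr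
    exact (le_abs_self _).trans ((hM₁ _ (unitDirection y hy).2).trans
      ((le_max_left _ _).trans (le_max_right _ _)))
  · have hy' : 0 < ‖y‖ := norm_pos_iff.2 hy
    rw [finrank_eucl]
    -- differentiating the homogeneity relation
    set u : Eucl n := (unitDirection y hy : Eucl n) with hu
    have hyu : y = ‖y‖ • u := hscale y hy
    have h3 : ‖y‖ • fderiv ℝ (stableDensity α f) (‖y‖ • u) =
        ‖y‖ ^ (-((n + 1 : ℕ) : ℝ) - α) • fderiv ℝ (stableDensity α f) u := by
      rw [← fderiv_comp_smul (f := stableDensity α f)]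
      have : (fun x : Eucl n => stableDensity α f (‖y‖ • x)) =
          fun x => ‖y‖ ^ (-((n + 1 : ℕ) : ℝ) - α) • stableDensity α f x := by
        funext x; rw [stableDensity_smul hy', smul_eq_mul]
      rw [this]
      exact fderiv_fun_const_smul ((contDiffAt_stableDensity hf
        (hne u (unitDirection y hy).2)).differentiableAt (by simp)) _
    rw [← hyu] at h3
    have h4 := congrArg norm h3
    rw [norm_smul, norm_smul, norm_norm, Real.norm_of_nonneg (by positivity)] at h4
    rw [Real.rpow_sub_one hy'.ne']
    have h5 : ‖fderiv ℝ (stableDensity α f) u‖ ≤ max 0 (max M₁ M₂) :=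
      (hM₂ _ (unitDirection y hy).2).trans ((le_max_right _ _).trans (le_max_right _ _))
    rw [mul_div_assoc', le_div_iff₀ hy', mul_comm _ ‖y‖, h4, mul_comm]
    gcongr

/-- Integration in polar coordinates. -/
lemma lintegral_polar {G : Eucl n → ENNReal} (hG : Measurable G) :
    ∫⁻ y, G y = ∫⁻ s, ∫⁻ r in Set.Ioi (0 : ℝ), ENNReal.ofReal (r ^ n) * G (r • (s : Eucl n))
      ∂volume ∂(surfaceMeasure n) := by
  have hmp := (volume : Measure (Eucl n)).measurePreserving_homeomorphUnitSphereProd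
  have hmeas : Measurable fun p : USphere n × Set.Ioi (0 : ℝ) =>
      G ((p.2 : ℝ) • (p.1 : Eucl n)) := by fun_prop
  calc ∫⁻ y, G y = ∫⁻ y in {0}ᶜ, G y := by rw [restrict_compl_singleton]
    _ = ∫⁻ x : ({0}ᶜ : Set (Eucl n)), G (x : Eucl n) ∂(Measure.comap Subtype.val volume) :=
        (lintegral_subtype_comap (measurableSet_singleton _).compl _).symm
    _ = ∫⁻ p, G ((p.2 : ℝ) • (p.1 : Eucl n)) ∂((surfaceMeasure n).prod (.volumeIoiPow n)) := by
        have h1 := hmp.lintegral_comp hmeas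
        rw [finrank_eucl, Nat.add_sub_cancel] at h1
        rw [surfaceMeasure, ← h1]
        refine lintegral_congr fun x => ?_
        congr 1
        have h2 : ‖(x : Eucl n)‖ ≠ 0 := norm_ne_zero_iff.2 x.2
        rw [homeomorphUnitSphereProd_apply_snd_coe, homeomorphUnitSphereProd_apply_fst_coe,
          smul_smul, mul_inv_cancel₀ h2, one_smul]
    _ = ∫⁻ s, ∫⁻ r, G ((r : ℝ) • (s : Eucl n)) ∂(.volumeIoiPow n) ∂(surfaceMeasure n) :=
        lintegral_prod _ hmeas.aemeasurable
    _ = _ := by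
        refine lintegral_congr fun s => ?_
        rw [Measure.volumeIoiPow, lintegral_withDensity_eq_lintegral_mul _ (by fun_prop)
          (by fun_prop)]
        exact lintegral_subtype_comap measurableSet_Ioi
          (fun r : ℝ => ENNReal.ofReal (r ^ n) * G (r • (s : Eucl n)))

/-- Integration against a stable Lévy measure, as an iterated integral. -/
lemma lintegral_stableLevyMeasure {α : ℝ} (μt : Measure (USphere n)) [SFinite μt]
    {G : Eucl n → ENNReal} (hG : Measurable G) :
    ∫⁻ y, G y ∂(stableLevyMeasure α μt) =
      ∫⁻ s, ∫⁻ r in Set.Ioi (0 : ℝ), ENNReal.ofReal (r ^ (-1 - α)) * G (r • (s : Eucl n))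
        ∂volume ∂μt := by
  rw [stableLevyMeasure, lintegral_map hG (by fun_prop), lintegral_prod_symm' _ (by fun_prop)]
  refine lintegral_congr fun s => ?_
  rw [lintegral_withDensity_eq_lintegral_mul _ (by fun_prop) (by fun_prop)]
  rfl

/-- A stable Lévy measure has the expected density with respect to Lebesgue measure: the Jacobian
`r ^ (d - 1)` of polar coordinates turns `r ^ (-d - α)` into `r ^ (-1 - α)`. -/
theorem stableLevyMeasure_withDensity {α : ℝ} {f : USphere n → ℝ}
    (hf : ContMDiff (𝓡 n) 𝓘(ℝ, ℝ) ∞ f) :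
    stableLevyMeasure α ((surfaceMeasure n).withDensity fun s => ENNReal.ofReal (f s)) =
      volume.withDensity fun y => ENNReal.ofReal (stableDensity α f y) := by
  have hfm : Measurable fun s => ENNReal.ofReal (f s) := hf.continuous.measurable.ennreal_ofReal
  have hdm : Measurable fun y => ENNReal.ofReal (stableDensity α f y) :=
    (measurable_stableDensity hf).ennreal_ofReal
  have : IsFiniteMeasure (surfaceMeasure n) := by unfold surfaceMeasure; infer_instance
  refine Measure.ext_of_lintegral _ fun G hG => ?_
  rw [lintegral_stableLevyMeasure _ hG, lintegral_withDensity_eq_lintegral_mul _ hdm hG,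
    lintegral_polar (hdm.mul hG), lintegral_withDensity_eq_lintegral_mul _ hfm]
  · refine lintegral_congr fun s => ?_
    simp only [Pi.mul_apply]
    rw [← lintegral_const_mul _ (by fun_prop)]
    refine setLIntegral_congr_fun measurableSet_Ioi fun r hr => ?_
    have hr' : (0 : ℝ) < r := hr
    have hpow : r ^ (-1 - α) = r ^ n * r ^ (-((n + 1 : ℕ) : ℝ) - α) := by
      rw [← Real.rpow_natCast, ← Real.rpow_add hr']
      congr 1
      push_cast; ring
    rw [stableDensity_smul_sphere hr', ENNReal.ofReal_mul (by positivity), hpow,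
      ENNReal.ofReal_mul (by positivity)]
    ring
  · exact Measurable.lintegral_prod_right'
      (f := fun p : USphere n × ℝ => ENNReal.ofReal (p.2 ^ (-1 - α)) * G (p.2 • (p.1 : Eucl n)))
      (by fun_prop)

instance (n : ℕ) : IsFiniteMeasure (surfaceMeasure n) := by
  unfold surfaceMeasure; infer_instance

instance (n : ℕ) : (surfaceMeasure n).IsOpenPosMeasure := by
  unfold surfaceMeasure; infer_instance

lemma isSymmetricMeasure_surfaceMeasure (n : ℕ) : IsSymmetricMeasure (surfaceMeasure n) := by
  refine Measure.ext fun s hs => ?_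
  have hneg : Measurable (fun s : USphere n => -s) := by fun_prop
  rw [Measure.map_apply hneg hs, surfaceMeasure, Measure.toSphere_apply' _ (hneg hs),
    Measure.toSphere_apply' _ hs]
  congr 1
  rw [← Measure.measure_preimage_neg volume
    (Set.Ioo (0 : ℝ) 1 • (Subtype.val '' s : Set (Eucl n)))]
  congr 1
  ext x
  simp only [Set.mem_smul, Set.mem_image, Set.mem_preimage]
  constructor
  · rintro ⟨r, hr, _, ⟨a, ha, rfl⟩, rfl⟩
    exact ⟨r, hr, _, ⟨-a, ha, rfl⟩, by simp⟩
  · rintro ⟨r, hr, _, ⟨a, ha, rfl⟩, hx⟩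
    refine ⟨r, hr, _, ⟨-a, by simpa using ha, rfl⟩, ?_⟩
    rw [← neg_neg x, ← hx]
    simp

end Polar

/-! ### The symbol of a symmetric stable operator -/

section Symbol

open scoped RealInnerProductSpace

lemma integrableOn_one_sub_cos_mul_rpow {α : ℝ} (hα0 : 0 < α) (hα1 : α < 1) :
    IntegrableOn (fun r : ℝ => (1 - Real.cos r) * r ^ (-1 - α)) (Set.Ioi 0) := by
  have hmeas : Measurable fun r : ℝ => (1 - Real.cos r) * r ^ (-1 - α) := by fun_prop
  rw [← Set.Ioc_union_Ioi_eq_Ioi zero_le_one]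
  refine IntegrableOn.union ?_ ?_
  · have h1 : IntegrableOn (fun r : ℝ => r ^ (-α)) (Set.Ioc 0 1) :=
      (intervalIntegrable_iff_integrableOn_Ioc_of_le zero_le_one).1
        (intervalIntegral.intervalIntegrable_rpow' (by linarith))
    refine h1.mono' hmeas.aestronglyMeasurable ?_
    refine (ae_restrict_iff' measurableSet_Ioc).2 (.of_forall fun r hr => ?_)
    have hr0 : 0 < r := hr.1
    rw [Real.norm_of_nonneg (mul_nonneg (by linarith [Real.cos_le_one r]) (by positivity))]
    calc (1 - Real.cos r) * r ^ (-1 - α) ≤ r * r ^ (-1 - α) := by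
          gcongr
          simpa [abs_of_pos hr0] using one_sub_cos_le_abs r
      _ = r ^ (-α) := by
          rw [← Real.rpow_one_add' hr0.le (by linarith)]
          congr 1; ring
  · have h1 : IntegrableOn (fun r : ℝ => 2 * r ^ (-1 - α)) (Set.Ioi 1) :=
      (integrableOn_Ioi_rpow_of_lt (by linarith) one_pos).const_mul 2
    refine h1.mono' hmeas.aestronglyMeasurable ?_
    refine (ae_restrict_iff' measurableSet_Ioi).2 (.of_forall fun r hr => ?_)
    have hr0 : (0 : ℝ) < r := one_pos.trans hr
    rw [Real.norm_of_nonneg (mul_nonneg (by linarith [Real.cos_le_one r]) (by positivity))]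
    gcongr
    linarith [Real.neg_one_le_cos r]

lemma spectralConst_pos {α : ℝ} (hα0 : 0 < α) (hα1 : α < 1) : 0 < spectralConst α := by
  have hnn : ∀ r ∈ Set.Ioi (0 : ℝ), 0 ≤ (1 - Real.cos r) * r ^ (-1 - α) := fun r hr =>
    mul_nonneg (by linarith [Real.cos_le_one r]) (Real.rpow_nonneg (le_of_lt hr) _)
  refine (setIntegral_pos_iff_support_of_nonneg_ae
    ((ae_restrict_iff' measurableSet_Ioi).2 (.of_forall hnn))
    (integrableOn_one_sub_cos_mul_rpow hα0 hα1)).2 ?_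
  have hsub : Set.Ioo (0 : ℝ) 1 ⊆
      Function.support (fun r : ℝ => (1 - Real.cos r) * r ^ (-1 - α)) ∩ Set.Ioi 0 := by
    intro r hr
    refine ⟨?_, hr.1⟩
    have h1 : Real.cos r < 1 := by
      rw [← Real.cos_zero]
      exact Real.cos_lt_cos_of_nonneg_of_le_pi le_rfl (by linarith [hr.2, Real.pi_gt_three]) hr.1
    exact (mul_pos (by linarith) (Real.rpow_pos_of_pos hr.1 _)).ne'
  refine lt_of_lt_of_le ?_ (measure_mono hsub)
  simp

/-- The radial part of the Lévy–Khintchine integral; the substitution `r ↦ |a| r` produces the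
factor `|a| ^ α`. -/
lemma lintegral_rpow_mul_one_sub_cos {α : ℝ} (hα0 : 0 < α) (hα1 : α < 1) (a : ℝ) :
    ∫⁻ r in Set.Ioi (0 : ℝ),
        ENNReal.ofReal (r ^ (-1 - α)) * ENNReal.ofReal (1 - Real.cos (r * a)) =
      ENNReal.ofReal (spectralConst α) * ENNReal.ofReal (|a| ^ α) := by
  rcases eq_or_ne a 0 with rfl | ha
  · simp [Real.zero_rpow hα0.ne']
  have hb : 0 < |a| := abs_pos.2 ha
  set h : ℝ → ℝ := fun r => (1 - Real.cos r) * r ^ (-1 - α) with hh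
  have hint : IntegrableOn (fun r => h (|a| * r)) (Set.Ioi 0) := by
    rw [integrableOn_Ioi_comp_mul_left_iff h 0 hb, mul_zero]
    exact integrableOn_one_sub_cos_mul_rpow hα0 hα1
  have hval : ∫ r in Set.Ioi (0 : ℝ), h (|a| * r) = |a|⁻¹ * spectralConst α := by
    rw [integral_comp_mul_left_Ioi h 0 hb, mul_zero, smul_eq_mul, spectralConst]
  calc _ = ∫⁻ r in Set.Ioi (0 : ℝ), ENNReal.ofReal (|a| ^ (1 + α) * h (|a| * r)) := by
        refine setLIntegral_congr_fun measurableSet_Ioi fun r hr => ?_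
        have hr' : (0 : ℝ) < r := hr
        have h1 : Real.cos (r * a) = Real.cos (|a| * r) := by
          rw [← Real.cos_abs, abs_mul, abs_of_pos hr', mul_comm]
        have h2 : |a| ^ (1 + α) * |a| ^ (-1 - α) = 1 := by
          rw [← Real.rpow_add hb, show 1 + α + (-1 - α) = 0 by ring, Real.rpow_zero]
        rw [← ENNReal.ofReal_mul (by positivity), h1]
        congr 1
        simp only [hh]
        rw [Real.mul_rpow hb.le hr'.le]
        linear_combination (-(1 - Real.cos (|a| * r)) * r ^ (-1 - α)) * h2
    _ = ENNReal.ofReal (∫ r in Set.Ioi (0 : ℝ), |a| ^ (1 + α) * h (|a| * r)) := by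
        refine (ofReal_integral_eq_lintegral_ofReal (hint.const_mul _) ?_).symm
        refine (ae_restrict_iff' measurableSet_Ioi).2 (.of_forall fun r hr => ?_)
        have hr' : (0 : ℝ) < r := hr
        exact mul_nonneg (by positivity) (mul_nonneg
          (by linarith [Real.cos_le_one (|a| * r)]) (by positivity))
    _ = _ := by
        rw [integral_const_mul, hval, ← ENNReal.ofReal_mul (spectralConst_pos hα0 hα1).le,
          Real.rpow_add hb, Real.rpow_one]
        congr 1
        field_simp

variable {n : ℕ}

/-- The Lévy–Khintchine integral of a symmetric stable measure in terms of its spectral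
measure. -/
lemma lintegral_one_sub_cos_stableLevyMeasure {α : ℝ} (hα0 : 0 < α) (hα1 : α < 1)
    (μt : Measure (USphere n)) [SFinite μt] (ξ : Eucl n) :
    ∫⁻ y, ENNReal.ofReal (1 - Real.cos ⟪ξ, y⟫) ∂(stableLevyMeasure α μt) =
      ∫⁻ s, ENNReal.ofReal (|⟪ξ, (s : Eucl n)⟫| ^ α) ∂(spectralMeasure α μt) := by
  rw [lintegral_stableLevyMeasure μt (by fun_prop), spectralMeasure, lintegral_smul_measure,
    smul_eq_mul, ← lintegral_const_mul _ (by fun_prop)]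
  refine lintegral_congr fun s => ?_
  rw [← lintegral_rpow_mul_one_sub_cos hα0 hα1]
  simp_rw [real_inner_smul_right]

lemma spectralIntegral_smul {α : ℝ} (μ : Measure (USphere n)) {r : ℝ} (hr : 0 ≤ r)
    (ξ : Eucl n) : spectralIntegral α μ (r • ξ) = r ^ α * spectralIntegral α μ ξ := by
  rw [spectralIntegral, spectralIntegral, ← integral_const_mul]
  refine integral_congr_ae (.of_forall fun s => ?_)
  simp only
  rw [real_inner_smul_left, abs_mul, abs_of_nonneg hr, Real.mul_rpow hr (abs_nonneg _)]

lemma spectralIntegral_neg {α : ℝ} (μ : Measure (USphere n)) (ξ : Eucl n) :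
    spectralIntegral α μ (-ξ) = spectralIntegral α μ ξ := by
  simp only [spectralIntegral, inner_neg_left, abs_neg]

lemma continuous_spectralIntegral {α : ℝ} (hα : 0 ≤ α) (μ : Measure (USphere n))
    [IsFiniteMeasure μ] : Continuous (spectralIntegral α μ) := by
  have h := continuous_parametric_integral_of_continuous (μ := μ)
    (f := fun (ξ : Eucl n) (s : USphere n) => |⟪ξ, (s : Eucl n)⟫| ^ α)
    (by
      refine Continuous.rpow_const ?_ fun _ => Or.inr hα
      exact (Continuous.inner continuous_fst (continuous_subtype_val.comp continuous_snd)).abs)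
    isCompact_univ
  simp only [setIntegral_univ] at h
  exact h

instance {α : ℝ} (μt : Measure (USphere n)) [IsFiniteMeasure μt] :
    IsFiniteMeasure (spectralMeasure α μt) := by
  unfold spectralMeasure
  exact Measure.smul_finite _ ENNReal.ofReal_ne_top

/-- If the stable Lévy measure has density `m`, then `Ψ(2πξ) = -∫ (1 - cos (2π⟨w,ξ⟩)) m(w) dw`. -/
lemma cosSymbol_eq_spectralIntegral {α : ℝ} (hα0 : 0 < α) (hα1 : α < 1)
    (μt : Measure (USphere n)) [SFinite μt] {m : Eucl n → ℝ} (hm : Measurable m)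
    (hm0 : ∀ y, 0 ≤ m y)
    (hν : stableLevyMeasure α μt = volume.withDensity fun y => ENNReal.ofReal (m y))
    (ξ : Eucl n) :
    cosSymbol m ξ = spectralIntegral α (spectralMeasure α μt) ((2 * Real.pi) • ξ) := by
  rw [cosSymbol, spectralIntegral, integral_eq_lintegral_of_nonneg_ae,
    integral_eq_lintegral_of_nonneg_ae, ← lintegral_one_sub_cos_stableLevyMeasure hα0 hα1, hν,
    lintegral_withDensity_eq_lintegral_mul _ hm.ennreal_ofReal (by fun_prop)]
  · congr 1
    refine lintegral_congr fun w => ?_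
    rw [ENNReal.ofReal_mul (one_sub_cos_inner_nonneg w ξ), Pi.mul_apply, mul_comm,
      real_inner_smul_left, real_inner_comm]
  · exact .of_forall fun s => by positivity
  · refine (Continuous.rpow_const ?_ fun _ => Or.inr hα0.le).aestronglyMeasurable
    fun_prop
  · exact .of_forall fun w => mul_nonneg (one_sub_cos_inner_nonneg w ξ) (hm0 w)
  · exact (by fun_prop : Measurable fun w : Eucl n =>
      (1 - Real.cos (2 * Real.pi * ⟪w, ξ⟫)) * m w).aestronglyMeasurable

/-- A stable Lévy measure with an even density has the real symbol `-∫ |⟨ξ,s⟩|^α μ(ds)`. -/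
lemma levySymbol_eq_neg_spectralIntegral {α M : ℝ} (hα0 : 0 < α) (hα1 : α < 1)
    (μt : Measure (USphere n)) [SFinite μt] {m : Eucl n → ℝ} (hm : Measurable m)
    (h : IsStableDensity α M m)
    (hν : stableLevyMeasure α μt = volume.withDensity fun y => ENNReal.ofReal (m y))
    (ξ : Eucl n) :
    levySymbol (stableLevyMeasure α μt) ξ =
      -(spectralIntegral α (spectralMeasure α μt) ξ : ℂ) := by
  have hint : Integrable (fun y => m y • (Complex.exp (Complex.I * (⟪ξ, y⟫ : ℝ)) - 1)) := by
    refine ((h.integrable_min_mul hα0 hα1).const_mul (2 + ‖ξ‖)).mono'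
      (by fun_prop) (.of_forall fun y => ?_)
    rw [norm_smul, Real.norm_of_nonneg (h.nonneg y), mul_comm, ← mul_assoc]
    refine mul_le_mul_of_nonneg_right ?_ (h.nonneg y)
    have h1 : ‖Complex.exp (Complex.I * (⟪ξ, y⟫ : ℝ)) - 1‖ ≤ 2 := by
      refine (norm_sub_le _ _).trans ?_
      rw [mul_comm, Complex.norm_exp_ofReal_mul_I, norm_one]
      norm_num
    have h2 : ‖Complex.exp (Complex.I * (⟪ξ, y⟫ : ℝ)) - 1‖ ≤ ‖ξ‖ * ‖y‖ :=
      (Real.norm_exp_I_mul_ofReal_sub_one_le).trans (norm_inner_le_norm _ _)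
    rcases le_total 1 ‖y‖ with hy | hy
    · rw [min_eq_left hy]
      linarith [norm_nonneg ξ]
    · rw [min_eq_right hy]
      nlinarith [norm_nonneg ξ, norm_nonneg y]
  set J := ∫ y, m y • (Complex.exp (Complex.I * (⟪ξ, y⟫ : ℝ)) - 1) with hJ
  have hL : levySymbol (stableLevyMeasure α μt) ξ = J := by
    rw [levySymbol, hν, integral_withDensity_eq_integral_toReal_smul hm.ennreal_ofReal
      (.of_forall fun _ => ENNReal.ofReal_lt_top)]
    simp_rw [ENNReal.toReal_ofReal (h.nonneg _)]
    rfl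
  have hconj : (starRingEnd ℂ) J = J := by
    rw [hJ, ← integral_conj, ← integral_neg_eq_self]
    refine integral_congr_ae ?_
    filter_upwards [h.even] with w hw
    rw [hw, inner_neg_right]
    simp [← Complex.exp_conj]
  have hre : J.re = -spectralIntegral α (spectralMeasure α μt) ξ := by
    have h1 := cosSymbol_eq_spectralIntegral hα0 hα1 μt hm h.nonneg hν ((2 * Real.pi)⁻¹ • ξ)
    rw [smul_smul, mul_inv_cancel₀ (by positivity), one_smul] at h1
    rw [← h1, hJ, ← Complex.reCLM_apply, ← Complex.reCLM.integral_comp_comm hint, cosSymbol,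
      ← integral_neg]
    refine integral_congr_ae (.of_forall fun w => ?_)
    simp only [Complex.reCLM_apply, Complex.smul_re, real_inner_smul_right]
    rw [mul_comm Complex.I, Complex.sub_re, Complex.exp_ofReal_mul_I_re, Complex.one_re,
      mul_inv_cancel_left₀ (by positivity), real_inner_comm, smul_eq_mul]
    ring
  rw [hL, ← Complex.ofReal_neg, ← hre]
  exact (Complex.conj_eq_iff_re.1 hconj).symm

lemma map_neg_withDensity {g : USphere n → ENNReal} (hg : Measurable g) :
    ((surfaceMeasure n).withDensity g).map (fun s => -s) =
      (surfaceMeasure n).withDensity fun s => g (-s) := by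
  have hneg : Measurable (fun s : USphere n => -s) := by fun_prop
  refine Measure.ext_of_lintegral _ fun G hG => ?_
  have hG' : Measurable fun s => G (-s) := hG.comp hneg
  have hg' : Measurable fun s => g (-s) := hg.comp hneg
  rw [lintegral_map hG hneg, lintegral_withDensity_eq_lintegral_mul _ hg hG',
    lintegral_withDensity_eq_lintegral_mul _ hg' hG]
  conv_rhs => rw [← isSymmetricMeasure_surfaceMeasure n, lintegral_map (by fun_prop) hneg]
  simp

/-- A symmetric stable Lévy measure whose spectral measure has a smooth density has a density
with respect to Lebesgue measure to which the estimates apply. -/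
theorem exists_density_stableLevyMeasure {α : ℝ} (hα0 : 0 < α) (hα1 : α < 1)
    {μt : Measure (USphere n)} (hsymm : IsSymmetricMeasure μt)
    (hd : HasSmoothEquivalentDensity (spectralMeasure α μt)) :
    ∃ (m : Eucl n → ℝ) (M : ℝ), Measurable m ∧ IsStableDensity α M m ∧
      stableLevyMeasure α μt = volume.withDensity fun y => ENNReal.ofReal (m y) := by
  obtain ⟨⟨f, hf, hf0, hμ⟩, -⟩ := hd
  have hκ := spectralConst_pos hα0 hα1
  set g : USphere n → ℝ := fun s => (spectralConst α)⁻¹ * f s with hg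
  have hgs : ContMDiff (𝓡 n) 𝓘(ℝ, ℝ) ∞ g := contMDiff_const.mul hf
  have hg0 : ∀ s, 0 ≤ g s := fun s => mul_nonneg (inv_nonneg.2 hκ.le) (hf0 s)
  have hgm : Measurable fun s => ENNReal.ofReal (g s) := hgs.continuous.measurable.ennreal_ofReal
  have hμt : μt = (surfaceMeasure n).withDensity fun s => ENNReal.ofReal (g s) := by
    have h1 : μt = (ENNReal.ofReal (spectralConst α))⁻¹ • spectralMeasure α μt := by
      rw [spectralMeasure, smul_smul, ENNReal.inv_mul_cancel
        (ENNReal.ofReal_pos.2 hκ).ne' ENNReal.ofReal_ne_top, one_smul]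
    rw [h1, hμ, ← withDensity_smul _ hf.continuous.measurable.ennreal_ofReal]
    congr 1
    funext s
    rw [Pi.smul_apply, smul_eq_mul, ← ENNReal.ofReal_inv_of_pos hκ,
      ← ENNReal.ofReal_mul (inv_nonneg.2 hκ.le)]
  -- symmetry of the measure makes the density even almost everywhere, hence everywhere
  have hge : ∀ s, g (-s) = g s := by
    have h1 := hsymm
    rw [IsSymmetricMeasure, hμt, map_neg_withDensity hgm] at h1
    have h2 := (withDensity_eq_iff_of_sigmaFinite (hgm.comp measurable_neg).aemeasurable
      hgm.aemeasurable).1 h1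
    have h3 : (fun s => g (-s)) =ᵐ[surfaceMeasure n] g := by
      filter_upwards [h2] with s hs
      exact (ENNReal.ofReal_eq_ofReal_iff (hg0 _) (hg0 _)).1 hs
    have h4 := (Continuous.ae_eq_iff_eq (surfaceMeasure n)
      (hgs.continuous.comp continuous_neg) hgs.continuous).1 h3
    exact fun s => congrFun h4 s
  obtain ⟨M, hM⟩ := exists_isStableDensity (α := α) hgs hg0 hge
  refine ⟨stableDensity α g, M, measurable_stableDensity hgs, hM, ?_⟩
  rw [hμt, stableLevyMeasure_withDensity hgs]

end Symbol

/-! ### The heat kernel: scaling, derivatives and law -/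

section Kernel

open scoped RealInnerProductSpace FourierTransform

/-- A finite measure whose characteristic function is the Fourier transform of a continuous
integrable function has that function as its density; in particular the function is
nonnegative. -/
lemma eq_withDensity_of_charFun_eq {E : Type*} [NormedAddCommGroup E] [InnerProductSpace ℝ E]
    [FiniteDimensional ℝ E] [MeasurableSpace E] [BorelSpace E] {P : Measure E}
    [IsFiniteMeasure P] {g : E → ℝ} (hg : Integrable g) (hgc : Continuous g)
    (h : ∀ ξ, charFun P ξ = ∫ y, g y • Complex.exp (⟪y, ξ⟫ * Complex.I)) :
    P = volume.withDensity fun y => ENNReal.ofReal (g y) := by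
  set Q₁ : Measure E := volume.withDensity fun y => ENNReal.ofReal (g y) with hQ₁
  set Q₂ : Measure E := volume.withDensity fun y => ENNReal.ofReal (-g y) with hQ₂
  have hm₁ : Measurable fun y => ENNReal.ofReal (g y) := by fun_prop
  have hm₂ : Measurable fun y => ENNReal.ofReal (-g y) := by fun_prop
  have : IsFiniteMeasure Q₁ := isFiniteMeasure_withDensity_ofReal hg.2
  have : IsFiniteMeasure Q₂ := isFiniteMeasure_withDensity_ofReal hg.neg.2
  have hexp : ∀ (Q : Measure E) [IsFiniteMeasure Q] (ξ : E),
      Integrable (fun y => Complex.exp (⟪y, ξ⟫ * Complex.I)) Q := fun Q _ ξ =>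
    (integrable_const (1 : ℝ)).mono' (by fun_prop)
      (.of_forall fun y => (Complex.norm_exp_ofReal_mul_I _).le)
  have hbd : ∀ (k : E → ℝ), Integrable k → ∀ ξ : E,
      Integrable (fun y => k y • Complex.exp (⟪y, ξ⟫ * Complex.I)) := by
    intro k hk ξ
    refine hk.norm.mono' (hk.1.smul (by fun_prop)) (.of_forall fun y => ?_)
    rw [norm_smul, Complex.norm_exp_ofReal_mul_I, mul_one]
  -- the transforms of the positive and negative parts of `g` differ by that of `P`
  have hsum : P + Q₂ = Q₁ := by
    refine Measure.ext_of_charFun (funext fun ξ => ?_)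
    have e₁ : charFun Q₁ ξ = ∫ y, max (g y) 0 • Complex.exp (⟪y, ξ⟫ * Complex.I) := by
      rw [charFun_apply, hQ₁, integral_withDensity_eq_integral_toReal_smul hm₁
        (.of_forall fun _ => ENNReal.ofReal_lt_top)]
      simp_rw [ENNReal.toReal_ofReal']
    have e₂ : charFun Q₂ ξ = ∫ y, max (-g y) 0 • Complex.exp (⟪y, ξ⟫ * Complex.I) := by
      rw [charFun_apply, hQ₂, integral_withDensity_eq_integral_toReal_smul hm₂
        (.of_forall fun _ => ENNReal.ofReal_lt_top)]
      simp_rw [ENNReal.toReal_ofReal']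
    have e₃ : charFun (P + Q₂) ξ = charFun P ξ + charFun Q₂ ξ := by
      simp only [charFun_apply]
      exact integral_add_measure (hexp P ξ) (hexp Q₂ ξ)
    rw [e₃, h, e₁, e₂,
      ← integral_add (hbd g hg ξ) (hbd (fun y => max (-g y) 0) hg.neg.pos_part ξ)]
    refine integral_congr_ae (.of_forall fun y => ?_)
    simp only
    rw [← add_smul]
    congr 1
    rcases le_total 0 (g y) with hy | hy
    · rw [max_eq_right (by linarith), max_eq_left hy, add_zero]
    · rw [max_eq_left (by linarith), max_eq_right hy, add_neg_cancel]
  -- the negative part is carried by a null set of the positive part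
  have hzero : Q₂ = 0 := by
    set S : Set E := {y | g y < 0}
    have hS : MeasurableSet S := measurableSet_lt hgc.measurable measurable_const
    have h1 : Q₁ S = 0 := by
      rw [hQ₁, withDensity_apply _ hS, setLIntegral_eq_zero_iff hS hm₁]
      exact .of_forall fun y hy => ENNReal.ofReal_of_nonpos (le_of_lt hy)
    have h2 : Q₂ Sᶜ = 0 := by
      rw [hQ₂, withDensity_apply _ hS.compl, setLIntegral_eq_zero_iff hS.compl hm₂]
      refine .of_forall fun y hy => ENNReal.ofReal_of_nonpos ?_
      have : ¬ g y < 0 := hy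
      linarith
    have h3 : Q₂ S = 0 := by
      rw [← hsum, Measure.add_apply] at h1
      exact (add_eq_zero.1 h1).2
    rw [← Measure.measure_univ_eq_zero, ← Set.union_compl_self S]
    exact measure_union_null h3 h2
  rw [← hsum, hzero, add_zero]

variable {n : ℕ}

/-- The heat kernel as a Fourier transform in Mathlib's normalisation. -/
lemma stableHeatKernel_eq_re_fourier (α : ℝ) (μ : Measure (USphere n)) (t : ℝ) (y : Eucl n) :
    stableHeatKernel α μ t y =
      (𝓕 (fun ξ : Eucl n =>
        (Real.exp (-t * spectralIntegral α μ ((2 * Real.pi) • ξ)) : ℂ)) y).re := by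
  set F : Eucl n → ℂ := fun ξ => Complex.exp (-(Complex.I * (inner ℝ y ξ : ℝ))) *
      (Real.exp (-t * spectralIntegral α μ ξ) : ℂ) with hF
  have h1 := Measure.integral_comp_smul (volume : Measure (Eucl n)) F (2 * Real.pi)
  rw [finrank_eucl, abs_of_nonneg (by positivity)] at h1
  have h2 : 𝓕 (fun ξ : Eucl n =>
      (Real.exp (-t * spectralIntegral α μ ((2 * Real.pi) • ξ)) : ℂ)) y =
      ∫ ξ, F ((2 * Real.pi) • ξ) := by
    rw [Real.fourier_eq]
    refine integral_congr_ae (.of_forall fun ξ => ?_)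
    simp only [hF]
    rw [Circle.smul_def, Real.fourierChar_apply, smul_eq_mul, real_inner_smul_right,
      real_inner_comm]
    congr 2
    push_cast; ring
  rw [h2, h1, Complex.smul_re, stableHeatKernel, smul_eq_mul]

/-- The self-similarity of the Fourier transform of `exp (-t ψ)`, for `ψ` homogeneous of
degree `α`. -/
lemma fourier_exp_neg_mul_spectralIntegral {α : ℝ} (μ : Measure (USphere n))
    {b : ℝ} (hb : 0 < b) (y : Eucl n) :
    𝓕 (fun ξ : Eucl n =>
        (Real.exp (-(b ^ (-α)) * spectralIntegral α μ ((2 * Real.pi) • ξ)) : ℂ)) y =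
      b ^ (n + 1) • 𝓕 (fun ξ : Eucl n =>
        (Real.exp (-spectralIntegral α μ ((2 * Real.pi) • ξ)) : ℂ)) (b • y) := by
  set F : Eucl n → ℂ := fun ξ => 𝐞 (-⟪ξ, y⟫) •
    (Real.exp (-(b ^ (-α)) * spectralIntegral α μ ((2 * Real.pi) • ξ)) : ℂ) with hF
  have h1 := Measure.integral_comp_smul (volume : Measure (Eucl n)) F b
  rw [finrank_eucl, abs_of_nonneg (by positivity)] at h1
  have h2 : 𝓕 (fun ξ : Eucl n =>
        (Real.exp (-spectralIntegral α μ ((2 * Real.pi) • ξ)) : ℂ)) (b • y) =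
      ∫ ξ, F (b • ξ) := by
    rw [Real.fourier_eq]
    refine integral_congr_ae (.of_forall fun ξ => ?_)
    simp only [hF]
    rw [real_inner_smul_left, real_inner_smul_right, smul_comm (2 * Real.pi) b ξ,
      spectralIntegral_smul μ hb.le, ← mul_assoc, neg_mul, ← Real.rpow_add hb, neg_add_cancel,
      Real.rpow_zero, neg_mul, one_mul]
  rw [h2, h1, smul_smul, mul_inv_cancel₀ (by positivity), one_smul, Real.fourier_eq]

/-- The weighted norms of the derivatives of a dilated function, in terms of the original. -/
lemma integral_rpow_mul_norm_iteratedFDeriv_smul {H : Eucl n → ℝ} (hH : ContDiff ℝ ∞ H)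
    {γ : ℝ} {j : ℕ} {b : ℝ} (hb : 0 < b)
    (hI : Integrable fun y => ‖y‖ ^ γ * ‖iteratedFDeriv ℝ j H y‖) :
    Integrable (fun y => ‖y‖ ^ γ * ‖iteratedFDeriv ℝ j (fun y => b ^ (n + 1) • H (b • y)) y‖) ∧
    ∫ y, ‖y‖ ^ γ * ‖iteratedFDeriv ℝ j (fun y => b ^ (n + 1) • H (b • y)) y‖ =
      b ^ ((j : ℝ) - γ) * ∫ y, ‖y‖ ^ γ * ‖iteratedFDeriv ℝ j H y‖ := by
  set g : Eucl n → ℝ := fun y => ‖y‖ ^ γ * ‖iteratedFDeriv ℝ j H y‖ with hg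
  have hpt : ∀ y, ‖y‖ ^ γ * ‖iteratedFDeriv ℝ j (fun y => b ^ (n + 1) • H (b • y)) y‖ =
      (b ^ ((j : ℝ) - γ) * b ^ (n + 1)) * g (b • y) := by
    intro y
    have h1 : ContDiff ℝ j fun y => H (b • y) :=
      (hH.comp (contDiff_const_smul b)).of_le (by exact_mod_cast le_top)
    have h2 : iteratedFDeriv ℝ j (fun y => b ^ (n + 1) • H (b • y)) y =
        b ^ (n + 1) • b ^ j • iteratedFDeriv ℝ j H (b • y) := by
      rw [iteratedFDeriv_const_smul_apply' h1.contDiffAt, iteratedFDeriv_comp_const_smul _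
        (hH.of_le (by exact_mod_cast le_top))]
    rw [h2, norm_smul, norm_smul, Real.norm_of_nonneg (by positivity),
      Real.norm_of_nonneg (by positivity)]
    simp only [hg]
    rw [norm_smul, Real.norm_of_nonneg hb.le, Real.mul_rpow hb.le (norm_nonneg _),
      Real.rpow_sub hb, Real.rpow_natCast]
    field_simp
  simp_rw [hpt]
  refine ⟨(hI.comp_smul hb.ne').const_mul _, ?_⟩
  rw [integral_const_mul, Measure.integral_comp_smul, finrank_eucl, smul_eq_mul,
    abs_of_nonneg (by positivity)]
  field_simp

/-- The Fourier transform of a real even function is real. -/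
lemma ofReal_re_fourier_of_even {E : Type*} [NormedAddCommGroup E] [InnerProductSpace ℝ E]
    [FiniteDimensional ℝ E] [MeasurableSpace E] [BorelSpace E] {f : E → ℝ}
    (hf : ∀ ξ, f (-ξ) = f ξ) (y : E) :
    ((𝓕 (fun ξ => (f ξ : ℂ)) y).re : ℂ) = 𝓕 (fun ξ => (f ξ : ℂ)) y := by
  refine Complex.conj_eq_iff_re.1 ?_
  rw [Real.fourier_eq, ← integral_conj, ← integral_neg_eq_self]
  refine integral_congr_ae (.of_forall fun ξ => ?_)
  simp only
  rw [hf, inner_neg_left, Circle.smul_def, Circle.smul_def, Real.fourierChar_apply,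
    Real.fourierChar_apply]
  simp [← Complex.exp_conj, Complex.conj_ofNat]

/-- The Fourier transform of `ξ ↦ exp (-∫ |⟨2πξ,s⟩|^α μ(ds))`, that is, the heat kernel at
time `1`. -/
def unitKernel (α : ℝ) (μ : Measure (USphere n)) : Eucl n → ℂ :=
  𝓕 fun ξ : Eucl n => (Real.exp (-spectralIntegral α μ ((2 * Real.pi) • ξ)) : ℂ)

lemma ofReal_re_unitKernel (α : ℝ) (μ : Measure (USphere n)) (y : Eucl n) :
    ((unitKernel α μ y).re : ℂ) = unitKernel α μ y :=
  ofReal_re_fourier_of_even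
    (f := fun ξ => Real.exp (-spectralIntegral α μ ((2 * Real.pi) • ξ)))
    (fun ξ => by rw [smul_neg, spectralIntegral_neg]) y

lemma stableHeatKernel_eq_unitKernel (α : ℝ) (μ : Measure (USphere n)) {b : ℝ} (hb : 0 < b) :
    stableHeatKernel α μ (b ^ (-α)) = fun y => b ^ (n + 1) • (unitKernel α μ (b • y)).re := by
  funext y
  rw [stableHeatKernel_eq_re_fourier, fourier_exp_neg_mul_spectralIntegral μ hb, Complex.smul_re]
  rfl

section Stable

variable {α η : ℝ} {μt : Measure (USphere n)} [IsFiniteMeasure μt]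

/-- The non-degeneracy of the spectral measure gives the lower bound on the symbol that the
regularity of the heat kernel rests on. -/
theorem unitKernel_regularity (hα0 : 0 < α) (hα1 : α < 1) (hsymm : IsSymmetricMeasure μt)
    (hη : IsNondegenerate α η (spectralMeasure α μt))
    (hd : HasSmoothEquivalentDensity (spectralMeasure α μt)) :
    Integrable (fun ξ : Eucl n =>
      (Real.exp (-spectralIntegral α (spectralMeasure α μt) ((2 * Real.pi) • ξ)) : ℂ)) ∧
    ContDiff ℝ ∞ (unitKernel α (spectralMeasure α μt)) ∧
    Integrable (unitKernel α (spectralMeasure α μt)) ∧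
    ∀ j : ℕ, Integrable fun y => (1 + ‖y‖) *
      ‖iteratedFDeriv ℝ (j + 1) (unitKernel α (spectralMeasure α μt)) y‖ := by
  obtain ⟨m, M, hm, h, hν⟩ := exists_density_stableLevyMeasure hα0 hα1 hsymm hd
  have hcos : cosSymbol m =
      fun ξ => spectralIntegral α (spectralMeasure α μt) ((2 * Real.pi) • ξ) :=
    funext fun ξ => cosSymbol_eq_spectralIntegral hα0 hα1 μt hm h.nonneg hν ξ
  have hη0 : 0 < η := one_pos.trans_le hη.1
  have hmain := h.fourier_exp_neg_cosSymbol hα0 hα1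
    (c := η⁻¹ * (2 * Real.pi) ^ α) (by positivity) (fun ξ => by
      rw [hcos]
      refine le_trans (le_of_eq ?_) (hη.2 _).1
      rw [norm_smul, Real.norm_of_nonneg (by positivity), Real.mul_rpow (by positivity)
        (norm_nonneg _), mul_assoc])
    (by
      rw [hcos]
      exact (continuous_spectralIntegral hα0.le _).comp (continuous_const_smul _))
  rw [hcos] at hmain
  exact hmain

theorem contDiff_stableHeatKernel (hα0 : 0 < α) (hα1 : α < 1) (hsymm : IsSymmetricMeasure μt)
    (hη : IsNondegenerate α η (spectralMeasure α μt))
    (hd : HasSmoothEquivalentDensity (spectralMeasure α μt)) {t : ℝ} (ht : 0 < t) :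
    ContDiff ℝ ∞ (stableHeatKernel α (spectralMeasure α μt) t) := by
  obtain ⟨-, hc, -⟩ := unitKernel_regularity hα0 hα1 hsymm hη hd
  have hb : t = (t ^ (-α⁻¹)) ^ (-α) := by
    rw [← Real.rpow_mul ht.le, neg_mul_neg, inv_mul_cancel₀ hα0.ne', Real.rpow_one]
  rw [hb, stableHeatKernel_eq_unitKernel α _ (by positivity)]
  exact (Complex.reCLM.contDiff.comp (hc.comp (contDiff_const_smul _))).const_smul _

/-- The law of the semigroup at time `t` has the heat kernel as its density, by Fourier
inversion. -/
theorem eq_withDensity_stableHeatKernel (hα0 : 0 < α) (hα1 : α < 1)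
    (hsymm : IsSymmetricMeasure μt) (hη : IsNondegenerate α η (spectralMeasure α μt))
    (hd : HasSmoothEquivalentDensity (spectralMeasure α μt)) {t : ℝ} (ht : 0 < t)
    {P : Measure (Eucl n)} (hP : IsSemigroupLaw (stableLevyMeasure α μt) t P) :
    P = volume.withDensity
      fun y => ENNReal.ofReal (stableHeatKernel α (spectralMeasure α μt) t y) := by
  have hPp := hP.1
  obtain ⟨hφi, hc, hi, -⟩ := unitKernel_regularity hα0 hα1 hsymm hη hd
  obtain ⟨m, M, hm, h, hν⟩ := exists_density_stableLevyMeasure hα0 hα1 hsymm hd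
  set μ := spectralMeasure α μt with hμ
  set b : ℝ := t ^ (-α⁻¹) with hb
  have hb0 : 0 < b := by positivity
  have hbt : b ^ (-α) = t := by
    rw [hb, ← Real.rpow_mul ht.le, neg_mul_neg, inv_mul_cancel₀ hα0.ne', Real.rpow_one]
  have hker := stableHeatKernel_eq_unitKernel α μ hb0
  rw [hbt] at hker
  refine eq_withDensity_of_charFun_eq ?_
    (contDiff_stableHeatKernel hα0 hα1 hsymm hη hd ht).continuous fun ξ => ?_
  · rw [hker]
    exact (hi.re.comp_smul hb0.ne').const_mul (b ^ (n + 1))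
  · -- Fourier inversion at the point `ξ / (2 π b)`
    have hφc : Continuous fun ξ : Eucl n =>
        (Real.exp (-spectralIntegral α μ ((2 * Real.pi) • ξ)) : ℂ) :=
      Complex.continuous_ofReal.comp (Real.continuous_exp.comp
        ((continuous_spectralIntegral hα0.le _).comp (continuous_const_smul _)).neg)
    have hinv := congrFun (hφc.fourierInv_fourier_eq hφi hi) ((2 * Real.pi * b)⁻¹ • ξ)
    rw [Real.fourierInv_eq] at hinv
    have hscale : (2 * Real.pi) • (2 * Real.pi * b)⁻¹ • ξ = b⁻¹ • ξ := by
      rw [smul_smul]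
      congr 1
      field_simp
    rw [hscale, spectralIntegral_smul μ (inv_nonneg.2 hb0.le), Real.inv_rpow hb0.le,
      ← Real.rpow_neg hb0.le, hbt] at hinv
    set F : Eucl n → ℂ := fun y =>
      (unitKernel α μ y).re • Complex.exp (⟪y, b⁻¹ • ξ⟫ * Complex.I) with hF
    have h1 : ∫ y, stableHeatKernel α μ t y • Complex.exp (⟪y, ξ⟫ * Complex.I) =
        ∫ y, b ^ (n + 1) • F (b • y) := by
      refine integral_congr_ae (.of_forall fun y => ?_)
      simp only [hF, hker]
      rw [real_inner_smul_left, real_inner_smul_right, mul_inv_cancel_left₀ hb0.ne', smul_assoc]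
    have h2 : ∫ y, F y = (Real.exp (-(t * spectralIntegral α μ ξ)) : ℂ) := by
      rw [← hinv]
      refine integral_congr_ae (.of_forall fun y => ?_)
      simp only [hF]
      rw [Complex.real_smul, ofReal_re_unitKernel, Circle.smul_def, Real.fourierChar_apply,
        smul_eq_mul, mul_comm, unitKernel, real_inner_smul_right, real_inner_smul_right]
      congr 3
      push_cast
      field_simp
    rw [h1, integral_smul, Measure.integral_comp_smul, finrank_eucl,
      abs_of_nonneg (by positivity), smul_smul, mul_inv_cancel₀ (by positivity), one_smul, h2,
      hP.2 ξ, levySymbol_eq_neg_spectralIntegral hα0 hα1 μt hm h hν, ← hμ]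
    push_cast
    ring_nf

/-- The scaling of the weighted integrals of the derivatives of the heat kernel in time is exact. -/
theorem exists_integral_rpow_mul_iteratedFDeriv_stableHeatKernel_eq (hα0 : 0 < α) (hα1 : α < 1)
    (hsymm : IsSymmetricMeasure μt) (hη : IsNondegenerate α η (spectralMeasure α μt))
    (hd : HasSmoothEquivalentDensity (spectralMeasure α μt)) {γ : ℝ} (hγ0 : 0 ≤ γ)
    (hγ1 : γ ≤ 1) (j : ℕ) :
    ∃ C : ℝ, 0 ≤ C ∧ ∀ t : ℝ, 0 < t →
      Integrable (fun y : Eucl n => ‖y‖ ^ γ *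
        ‖iteratedFDeriv ℝ (j + 1) (stableHeatKernel α (spectralMeasure α μt) t) y‖) ∧
      ∫ y : Eucl n, ‖y‖ ^ γ *
        ‖iteratedFDeriv ℝ (j + 1) (stableHeatKernel α (spectralMeasure α μt) t) y‖
          = C / t ^ (((j + 1 : ℕ) - γ) / α) := by
  obtain ⟨-, hc, -, hw⟩ := unitKernel_regularity hα0 hα1 hsymm hη hd
  set H : Eucl n → ℝ := fun y => (unitKernel α (spectralMeasure α μt) y).re with hH
  have hHc : ContDiff ℝ ∞ H := Complex.reCLM.contDiff.comp hc
  have hI : Integrable fun y => ‖y‖ ^ γ * ‖iteratedFDeriv ℝ (j + 1) H y‖ := by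
    refine (hw j).mono' ?_ (.of_forall fun y => ?_)
    · refine Continuous.aestronglyMeasurable ?_
      exact (continuous_norm.rpow_const fun _ => Or.inr hγ0).mul
        (hHc.continuous_iteratedFDeriv (by exact_mod_cast le_top)).norm
    · rw [Real.norm_of_nonneg (by positivity)]
      have h1 : ‖y‖ ^ γ ≤ 1 + ‖y‖ := by
        rcases le_total ‖y‖ 1 with hy | hy
        · linarith [Real.rpow_le_one (norm_nonneg y) hy hγ0, norm_nonneg y]
        · have := Real.rpow_le_rpow_of_exponent_le hy hγ1
          rw [Real.rpow_one] at this
          linarith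
      have h2 : ‖iteratedFDeriv ℝ (j + 1) H y‖ ≤
          ‖iteratedFDeriv ℝ (j + 1) (unitKernel α (spectralMeasure α μt)) y‖ := by
        refine (Complex.reCLM.norm_iteratedFDeriv_comp_left hc.contDiffAt
          (by exact_mod_cast le_top)).trans ?_
        rw [Complex.reCLM_norm, one_mul]
      gcongr
  refine ⟨∫ y, ‖y‖ ^ γ * ‖iteratedFDeriv ℝ (j + 1) H y‖,
    integral_nonneg fun y => by positivity, fun t ht => ?_⟩
  have hb0 : 0 < t ^ (-α⁻¹) := by positivity
  have hker := stableHeatKernel_eq_unitKernel α (spectralMeasure α μt) hb0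
  rw [← Real.rpow_mul ht.le, neg_mul_neg, inv_mul_cancel₀ hα0.ne', Real.rpow_one] at hker
  obtain ⟨h1, h2⟩ := integral_rpow_mul_norm_iteratedFDeriv_smul hHc hb0 hI
  rw [hker]
  refine ⟨h1, h2.trans ?_⟩
  rw [← Real.rpow_mul ht.le, neg_mul, Real.rpow_neg ht.le, inv_mul_eq_div, inv_mul_eq_div]

end Stable

end Kernel

/-! ### The isotropic stable operator -/

section Isotropic

open scoped RealInnerProductSpace

variable {n : ℕ}

lemma stableDensity_const (α c : ℝ) (y : Eucl n) (hy : y ≠ 0) :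
    stableDensity α (fun _ => c) y = c / ‖y‖ ^ (((n + 1 : ℕ) : ℝ) + α) := by
  rw [stableDensity_of_ne_zero hy, show -((n + 1 : ℕ) : ℝ) - α = -(((n + 1 : ℕ) : ℝ) + α) by ring,
    Real.rpow_neg (norm_nonneg _), mul_comm, div_eq_mul_inv]

lemma smul_surfaceMeasure_eq_withDensity (n : ℕ) (c : ℝ) :
    ENNReal.ofReal c • surfaceMeasure n =
      (surfaceMeasure n).withDensity fun _ => ENNReal.ofReal c :=
  (withDensity_const _).symm

lemma stableLevyMeasure_smul_surfaceMeasure (n : ℕ) (α c : ℝ) :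
    stableLevyMeasure α (ENNReal.ofReal c • surfaceMeasure n) =
      volume.withDensity
        fun y : Eucl n => ENNReal.ofReal (c / ‖y‖ ^ (((n + 1 : ℕ) : ℝ) + α)) := by
  rw [smul_surfaceMeasure_eq_withDensity,
    stableLevyMeasure_withDensity (f := fun _ => c) contMDiff_const]
  refine withDensity_congr_ae ?_
  filter_upwards [Measure.ae_ne volume (0 : Eucl n)] with y hy
  rw [stableDensity_const α c y hy]

lemma stableDensity_const_isometry (α c : ℝ) (R : Eucl n ≃ₗᵢ[ℝ] Eucl n) (y : Eucl n) :
    stableDensity α (fun _ => c) (R y) = stableDensity α (fun _ => c) y := by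
  rcases eq_or_ne y 0 with rfl | hy
  · rw [map_zero]
  · rw [stableDensity_const α c y hy, stableDensity_const α c (R y) (by simpa using hy),
      R.norm_map]

/-- The spectral integral of the surface measure only depends on the norm of its argument. The
rotation invariance that this rests on is that of Lebesgue measure, through the isotropic stable
density `‖y‖ ^ (-d - α)`. -/
lemma spectralIntegral_surfaceMeasure_congr {α : ℝ} (hα0 : 0 < α) (hα1 : α < 1)
    {ξ ξ' : Eucl n} (h : ‖ξ‖ = ‖ξ'‖) :
    spectralIntegral α (surfaceMeasure n) ξ = spectralIntegral α (surfaceMeasure n) ξ' := by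
  have hκ := spectralConst_pos hα0 hα1
  set m : Eucl n → ℝ := stableDensity α fun _ => 1 with hm
  have hν : stableLevyMeasure α (surfaceMeasure n) =
      volume.withDensity fun y => ENNReal.ofReal (m y) := by
    have := stableLevyMeasure_withDensity (n := n) (α := α) (f := fun _ => 1) contMDiff_const
    rwa [← smul_surfaceMeasure_eq_withDensity, ENNReal.ofReal_one, one_smul] at this
  have hcos : ∀ ζ : Eucl n, cosSymbol m ((2 * Real.pi)⁻¹ • ζ) =
      spectralConst α * spectralIntegral α (surfaceMeasure n) ζ := by
    intro ζ
    rw [cosSymbol_eq_spectralIntegral hα0 hα1 (surfaceMeasure n)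
      (measurable_stableDensity contMDiff_const) (stableDensity_nonneg fun _ => zero_le_one) hν,
      smul_smul, mul_inv_cancel₀ (by positivity), one_smul, spectralIntegral, spectralMeasure,
      integral_smul_measure, ENNReal.toReal_ofReal hκ.le, smul_eq_mul]
    rfl
  have hrot : ∀ (R : Eucl n ≃ₗᵢ[ℝ] Eucl n) (ζ : Eucl n), cosSymbol m (R ζ) = cosSymbol m ζ := by
    intro R ζ
    rw [cosSymbol, ← (R.measurePreserving).integral_comp R.toHomeomorph.measurableEmbedding]
    simp only [R.inner_map_map, hm, stableDensity_const_isometry]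
    rfl
  refine mul_left_cancel₀ hκ.ne' ?_
  rw [← hcos, ← hcos, ← Submodule.reflection_sub h, ← map_smul, hrot]

lemma exists_spectralIntegral_surfaceMeasure (n : ℕ) {α : ℝ} (hα0 : 0 < α) (hα1 : α < 1) :
    ∃ k : ℝ, 0 < k ∧ ∀ ξ : Eucl n,
      spectralIntegral α (surfaceMeasure n) ξ = k * ‖ξ‖ ^ α := by
  obtain ⟨e, he⟩ := exists_norm_eq (Eucl n) zero_le_one
  refine ⟨spectralIntegral α (surfaceMeasure n) e, ?_, fun ξ => ?_⟩
  · refine Continuous.integral_pos_of_hasCompactSupport_nonneg_nonzero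
      (x := (⟨e, by simpa using he⟩ : USphere n)) ?_ (HasCompactSupport.of_compactSpace _)
      (fun s => by positivity) ?_
    · exact Continuous.rpow_const (by fun_prop) fun _ => Or.inr hα0.le
    · rw [real_inner_self_eq_norm_sq, he]
      simp
  · rw [mul_comm, ← spectralIntegral_smul _ (norm_nonneg ξ)]
    refine spectralIntegral_surfaceMeasure_congr hα0 hα1 ?_
    rw [norm_smul, he, mul_one, norm_norm]

/-- A suitable multiple of the surface measure is the spherical part of the Lévy measure of the
fractional Laplacian. -/
theorem exists_isotropic_stable (n : ℕ) {α : ℝ} (hα0 : 0 < α) (hα1 : α < 1) :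
    ∃ c : ℝ, 0 < c ∧
      stableLevyMeasure α (ENNReal.ofReal c • surfaceMeasure n) =
        volume.withDensity
          (fun y : Eucl n => ENNReal.ofReal (c / ‖y‖ ^ (((n + 1 : ℕ) : ℝ) + α))) ∧
      (∀ ξ : Eucl n, levySymbol (stableLevyMeasure α (ENNReal.ofReal c • surfaceMeasure n)) ξ
        = -((‖ξ‖ ^ α : ℝ) : ℂ)) ∧
      IsFiniteMeasure (ENNReal.ofReal c • surfaceMeasure n) ∧
      IsSymmetricMeasure (ENNReal.ofReal c • surfaceMeasure n) ∧
      IsNondegenerate α 1 (spectralMeasure α (ENNReal.ofReal c • surfaceMeasure n)) ∧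
      HasSmoothEquivalentDensity
        (spectralMeasure α (ENNReal.ofReal c • surfaceMeasure n)) := by
  have hκ := spectralConst_pos hα0 hα1
  obtain ⟨k, hk, hkξ⟩ := exists_spectralIntegral_surfaceMeasure n hα0 hα1
  set c : ℝ := (spectralConst α * k)⁻¹ with hc
  have hc0 : 0 < c := by positivity
  have hfin : IsFiniteMeasure (ENNReal.ofReal c • surfaceMeasure n) :=
    Measure.smul_finite _ ENNReal.ofReal_ne_top
  have hspec : spectralMeasure α (ENNReal.ofReal c • surfaceMeasure n) =
      ENNReal.ofReal k⁻¹ • surfaceMeasure n := by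
    rw [spectralMeasure, smul_smul, ← ENNReal.ofReal_mul hκ.le, hc]
    congr 2
    field_simp
  have hψ : ∀ ξ : Eucl n, spectralIntegral α
      (spectralMeasure α (ENNReal.ofReal c • surfaceMeasure n)) ξ = ‖ξ‖ ^ α := by
    intro ξ
    rw [hspec, spectralIntegral, integral_smul_measure,
      ENNReal.toReal_ofReal (inv_nonneg.2 hk.le), smul_eq_mul]
    change k⁻¹ * spectralIntegral α (surfaceMeasure n) ξ = _
    rw [hkξ, inv_mul_cancel_left₀ hk.ne']
  refine ⟨c, hc0, stableLevyMeasure_smul_surfaceMeasure n α c, fun ξ => ?_, hfin, ?_, ?_, ?_⟩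
  · obtain ⟨M, hM⟩ := exists_isStableDensity (n := n) (α := α) (f := fun _ => c)
      contMDiff_const (fun _ => hc0.le) fun _ => rfl
    rw [levySymbol_eq_neg_spectralIntegral hα0 hα1 _ (measurable_stableDensity contMDiff_const)
      hM, hψ]
    rw [smul_surfaceMeasure_eq_withDensity,
      stableLevyMeasure_withDensity (f := fun _ => c) contMDiff_const]
  · rw [IsSymmetricMeasure, Measure.map_smul, isSymmetricMeasure_surfaceMeasure n]
  · exact ⟨le_rfl, fun ξ => by rw [hψ]; simp⟩
  · have hk0 : ENNReal.ofReal k⁻¹ ≠ 0 := (ENNReal.ofReal_pos.2 (inv_pos.2 hk)).ne'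
    rw [hspec]
    exact ⟨⟨fun _ => k⁻¹, contMDiff_const, fun _ => (inv_pos.2 hk).le,
      smul_surfaceMeasure_eq_withDensity n _⟩, Measure.smul_absolutelyContinuous,
      Measure.absolutelyContinuous_smul hk0⟩

end Isotropic

end

theorem proposition2 (n : ℕ) (α : ℝ) (hα0 : 0 < α) (hα1 : α < 1) :
    -- every symmetric stable operator in the class
    (∀ (μt : Measure (USphere n)), IsFiniteMeasure μt → IsSymmetricMeasure μt →
      ∀ η : ℝ, IsNondegenerate α η (spectralMeasure α μt) →
      HasSmoothEquivalentDensity (spectralMeasure α μt) →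
      -- the heat kernel is smooth and is the density of the laws of the semigroup
      (∀ t : ℝ, 0 < t →
        ContDiff ℝ ∞ (stableHeatKernel α (spectralMeasure α μt) t) ∧
        ∀ P : Measure (Eucl n), IsSemigroupLaw (stableLevyMeasure α μt) t P →
          P = volume.withDensity
            (fun y => ENNReal.ofReal (stableHeatKernel α (spectralMeasure α μt) t y))) ∧
      -- the integral estimate on its derivatives
      (∀ γ : ℝ, 0 ≤ γ → γ ≤ 1 → ∃ C : ℝ, 0 < C ∧ ∀ ℓ : ℕ, ℓ = 1 ∨ ℓ = 2 → ∀ t : ℝ, 0 < t →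
        Integrable (fun y : Eucl n => ‖y‖ ^ γ *
          ‖iteratedFDeriv ℝ ℓ (stableHeatKernel α (spectralMeasure α μt) t) y‖) ∧
        ∫ y : Eucl n, ‖y‖ ^ γ *
          ‖iteratedFDeriv ℝ ℓ (stableHeatKernel α (spectralMeasure α μt) t) y‖
            ≤ C / t ^ (((ℓ : ℝ) - γ) / α))) ∧
    -- the fractional Laplacian belongs to the class
    (∃ c : ℝ, 0 < c ∧
      stableLevyMeasure α (ENNReal.ofReal c • surfaceMeasure n) =
        volume.withDensity
          (fun y : Eucl n => ENNReal.ofReal (c / ‖y‖ ^ (((n + 1 : ℕ) : ℝ) + α))) ∧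
      (∀ ξ : Eucl n, levySymbol (stableLevyMeasure α (ENNReal.ofReal c • surfaceMeasure n)) ξ
        = -((‖ξ‖ ^ α : ℝ) : ℂ)) ∧
      IsFiniteMeasure (ENNReal.ofReal c • surfaceMeasure n) ∧
      IsSymmetricMeasure (ENNReal.ofReal c • surfaceMeasure n) ∧
      IsNondegenerate α 1 (spectralMeasure α (ENNReal.ofReal c • surfaceMeasure n)) ∧
      HasSmoothEquivalentDensity
        (spectralMeasure α (ENNReal.ofReal c • surfaceMeasure n))) := by
  refine ⟨fun μt hfin hsymm η hη hd => ⟨fun t ht => ⟨?_, fun P hP => ?_⟩, fun γ hγ0 hγ1 => ?_⟩,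
    exists_isotropic_stable n hα0 hα1⟩
  · exact contDiff_stableHeatKernel hα0 hα1 hsymm hη hd ht
  · exact eq_withDensity_stableHeatKernel hα0 hα1 hsymm hη hd ht hP
  · have hscaling := exists_integral_rpow_mul_iteratedFDeriv_stableHeatKernel_eq hα0 hα1 hsymm hη
      hd hγ0 hγ1
    obtain ⟨C₁, hC₁, h₁⟩ := hscaling 0
    obtain ⟨C₂, hC₂, h₂⟩ := hscaling 1
    -- the summand `1` only makes the constant positive
    refine ⟨C₁ + C₂ + 1, by positivity, fun ℓ hℓ t ht => ?_⟩
    rcases hℓ with rfl | rfl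
    · refine ⟨(h₁ t ht).1, (h₁ t ht).2.le.trans ?_⟩
      gcongr
      linarith
    · refine ⟨(h₂ t ht).1, (h₂ t ht).2.le.trans ?_⟩
      gcongr
      linarith
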